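/- Let $n\ge 0$, let $I\subseteq\mathbb R$ be an open interval (for instance $I=\mathbb R$), and for $t\in I$ let $\alpha_j=\alpha_j(t)\in\mathbb D=\{|z|<1\}$ $(0\le j\le n-1)$ and $\tau_n=\tau_n(t)\in\mathbb S^1=\{|z|=1\}$. Put $\rho_j=(1-|\alpha_j|^2)^{1/2}$, $\Theta_j=\begin{pmatrix}\overline{\alpha_j}&\rho_j\\ \rho_j&-\alpha_j\end{pmatrix}$, $G_j=\mathrm{diag}(I_j,\Theta_j,I_{n-j-1})$ for $0\le j\le n-1$, $G_n=\mathrm{diag}(I_n,\overline{\tau_n})$, and let $$G=G(t)=G_0G_1\cdots G_n ,$$ a unitary $(n+1)\times(n+1)$ upper Hessenberg matrix, which is assumed to be a differentiable function of $t\in I$. Its eigenvalues, which form the set $S=S(t)$, are the zeros of the paraorthogonal polynomial (POPUC) $P_{n+1}(z)=\det(z\,\mathrm I-G)$. Fix $\zeta\in\mathbb S^1$, a square root $\zeta^{1/2}$ of $\zeta$ with $\zeta^{-1/2}=\overline{\zeta^{1/2}}$, and a real number $p_0\neq0$, all independent of $t$. Whenever $\zeta\notin S(t)$ define $\tau_n(\zeta)=\tau_n$,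 $$\tau_j(\zeta)=\frac{\overline\zeta\,\alpha_j+\tau_{j+1}(\zeta)}{\overline{\alpha_j}\,\tau_{j+1}(\zeta)+\overline\zeta}\qquad (j=n-1,\dots,0),$$ and, with $\alpha_{-1}:=-1$, $$\beta_0=\frac1{\zeta^{-1/2}-\tau_0(\zeta)\,\zeta^{1/2}},\qquad \beta_{j+1}=\frac1{\beta_j}\cdot\frac1{\overline\zeta+\tau_j(\zeta)\overline{\alpha_{j-1}}}\cdot\frac1{1-\overline{\tau_j(\zeta)}\,\alpha_j}\qquad(j=0,\dots,n-1).$$ Let $p_{-1}(z)=0$, $p_0(z)=p_0$ and $p_{j+1}(z)=(\beta_j+\overline{\beta_j}\,z)\,p_j(z)-z\,p_{j-1}(z)$. Let $A$ be $\zeta^{1/2}$ times the lower bidiagonal matrix with diagonal $\overline{\beta_0},\dots,\overline{\beta_n}$ and all subdiagonal entries equal to $-1$, and put $H=(A+A^*)/2$, $K=(A-A^*)/(2i)$. (a) If $t\in I$ and $\zeta\notin S(t)$, then $H$ is positive definite at $t$, and $H^{-1/2}KH^{-1/2}$ is differentiable at $t$. (b) For every $t_0\in I$ and every $\eta_0\in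 S(t_0)$ there are an open interval $J$ with $t_0\in J\subseteq I$ and a continuous $\theta:J\to\mathbb R$ such that $\eta(t)=e^{i\theta(t)}$ is an eigenvalue of $G(t)$ for all $t\in J$ and $\eta(t_0)=\eta_0$. (c) Let $J\subseteq I$ be any open interval and let $\theta:J\to\mathbb R$ be any continuous function such that $\eta(t)=e^{i\theta(t)}$ is an eigenvalue of $G(t)$ for all $t\in J$. Then $\theta$ is differentiable on $J$, and for every $t\in J$ with $\zeta\notin S(t)$ the eigenvalue $\eta$ moves strictly counterclockwise along $\mathbb S^1$ at $t$, in the sense that $\theta'(t)>0$, if and only if $$\Big(\mathrm p,\;H^{1/2}\,\frac{\mathrm d}{\mathrm dt}\big(H^{-1/2}KH^{-1/2}\big)\,H^{1/2}\,\mathrm p\Big)<0 ,\qquad \mathrm p=\big(p_0(\eta),\dots,p_n(\eta)\big)^{\mathrm T},$$ where $(x,y)=\sum_i\overline{x_i}\,y_i$ and everything is taken at the time $t$. Moreover, if $T\subseteq J$ is an interval such that $\zeta\notin S(t)$ and this inequality holds for all $t\in T$, then $\theta$ is strictly increasing on $T$. -/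

import Mathlib

open scoped ComplexConjugate ComplexOrder MatrixOrder Topology

noncomputable section

namespace POPUC

/-- `ρ = (1 - |a|²)^{1/2}`. -/
def rho (a : ℂ) : ℝ := Real.sqrt (1 - ‖a‖ ^ 2)

/-- The `(n+1)`-by-`(n+1)` matrix `diag (I_j, Θ(a), I_{n-j-1})`, where
`Θ(a) = !![conj a, ρ; ρ, -a]` occupies the rows and columns `j` and `j + 1`
(numbered from `0`). -/
def givens (n j : ℕ) (a : ℂ) : Matrix (Fin (n + 1)) (Fin (n + 1)) ℂ :=
  Matrix.of fun r c =>
    if (r : ℕ) = j ∧ (c : ℕ) = j then conj a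
    else if (r : ℕ) = j ∧ (c : ℕ) = j + 1 then (rho a : ℂ)
    else if (r : ℕ) = j + 1 ∧ (c : ℕ) = j then (rho a : ℂ)
    else if (r : ℕ) = j + 1 ∧ (c : ℕ) = j + 1 then -a
    else if r = c then 1 else 0

/-- The matrix `diag (I_n, conj τ)`. -/
def lastFactor (n : ℕ) (τ : ℂ) : Matrix (Fin (n + 1)) (Fin (n + 1)) ℂ :=
  Matrix.diagonal fun i => if (i : ℕ) = n then conj τ else 1

/-- The unitary upper Hessenberg matrix `G(α_0, …, α_{n-1}, τ) = G_0 G_1 ⋯ G_{n-1} G_n`.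
Only the values `α 0, …, α (n - 1)` are used. -/
def matG (n : ℕ) (α : ℕ → ℂ) (τ : ℂ) : Matrix (Fin (n + 1)) (Fin (n + 1)) ℂ :=
  ((List.range n).map fun j => givens n j (α j)).prod * lastFactor n τ

/-- The paraorthogonal polynomial `P_{n+1}(z) = det (z I - G(α_0, …, α_{n-1}, τ))`. -/
def popuc (n : ℕ) (α : ℕ → ℂ) (τ : ℂ) : Polynomial ℂ := (matG n α τ).charpoly

/-- The pseudoreflection coefficients in reversed order: `tauRev n α τ ζ k = τ_{n-k}(ζ)`. -/
def tauRev (n : ℕ) (α : ℕ → ℂ) (τ ζ : ℂ) : ℕ → ℂ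
  | 0 => τ
  | k + 1 =>
    (conj ζ * α (n - 1 - k) + tauRev n α τ ζ k) /
      (conj (α (n - 1 - k)) * tauRev n α τ ζ k + conj ζ)

/-- The pseudoreflection coefficient `τ_j(ζ)`, for `0 ≤ j ≤ n`. -/
def tau (n : ℕ) (α : ℕ → ℂ) (τ ζ : ℂ) (j : ℕ) : ℂ := tauRev n α τ ζ (n - j)

theorem tau_last (n : ℕ) (α : ℕ → ℂ) (τ ζ : ℂ) : tau n α τ ζ n = τ := by
  simp [tau, tauRev]

theorem tau_of_lt (n : ℕ) (α : ℕ → ℂ) (τ ζ : ℂ) (j : ℕ) (hj : j < n) :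
    tau n α τ ζ j =
      (conj ζ * α j + tau n α τ ζ (j + 1)) / (conj (α j) * tau n α τ ζ (j + 1) + conj ζ) := by
  have h1 : n - j = (n - (j + 1)) + 1 := by omega
  have h2 : n - 1 - (n - (j + 1)) = j := by omega
  simp only [tau]
  rw [h1, tauRev, h2]

/-- The numbers `β_j(ζ)`, for `0 ≤ j ≤ n`; here `s` is the chosen square root of `ζ`, and
`α_{-1} = -1`. -/
def beta (n : ℕ) (α : ℕ → ℂ) (τ ζ s : ℂ) : ℕ → ℂ
  | 0 => 1 / (conj s - tau n α τ ζ 0 * s)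
  | j + 1 =>
    1 / beta n α τ ζ s j *
      (1 / (conj ζ + tau n α τ ζ j * conj (if j = 0 then -1 else α (j - 1)))) *
      (1 / (1 - conj (tau n α τ ζ j) * α j))

/-- The value at `z` of the polynomial `p_k(·, ζ)` generated from the coefficients `β` and the
constant `p_0` by `p_{k+1} = (β_k + conj β_k z) p_k - z p_{k-1}` with `p_{-1} = 0`. -/
def pVal (β : ℕ → ℂ) (p₀ : ℝ) (z : ℂ) : ℕ → ℂ
  | 0 => (p₀ : ℂ)
  | 1 => (β 0 + conj (β 0) * z) * (p₀ : ℂ)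
  | k + 2 => (β (k + 1) + conj (β (k + 1)) * z) * pVal β p₀ z (k + 1) - z * pVal β p₀ z k

/-- The vector `(p_0(z, ζ), …, p_n(z, ζ))`. -/
def pVec (n : ℕ) (α : ℕ → ℂ) (τ ζ s : ℂ) (p₀ : ℝ) (z : ℂ) : Fin (n + 1) → ℂ :=
  fun i => pVal (beta n α τ ζ s) p₀ z i

/-- The lower bidiagonal matrix `A`: `ζ^{1/2}` times the matrix with diagonal
`conj β_0, …, conj β_n` and subdiagonal entries `-1`. -/
def matA (n : ℕ) (α : ℕ → ℂ) (τ ζ s : ℂ) : Matrix (Fin (n + 1)) (Fin (n + 1)) ℂ :=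
  s • Matrix.of fun (i k : Fin (n + 1)) =>
    if i = k then conj (beta n α τ ζ s i) else if (i : ℕ) = (k : ℕ) + 1 then -1 else 0

/-- `H = (A + A*) / 2`. -/
def matH (n : ℕ) (α : ℕ → ℂ) (τ ζ s : ℂ) : Matrix (Fin (n + 1)) (Fin (n + 1)) ℂ :=
  (1 / 2 : ℂ) • (matA n α τ ζ s + (matA n α τ ζ s).conjTranspose)

/-- `K = (A - A*) / (2 i)`. -/
def matK (n : ℕ) (α : ℕ → ℂ) (τ ζ s : ℂ) : Matrix (Fin (n + 1)) (Fin (n + 1)) ℂ :=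
  (1 / (2 * Complex.I)) • (matA n α τ ζ s - (matA n α τ ζ s).conjTranspose)

/-- `H^{1/2}`, the positive square root of `H`. -/
def sqrtH (n : ℕ) (α : ℕ → ℂ) (τ ζ s : ℂ) : Matrix (Fin (n + 1)) (Fin (n + 1)) ℂ :=
  CFC.sqrt (matH n α τ ζ s)

/-- `H^{-1/2} K H^{-1/2}`. -/
def matX (n : ℕ) (α : ℕ → ℂ) (τ ζ s : ℂ) : Matrix (Fin (n + 1)) (Fin (n + 1)) ℂ :=
  (sqrtH n α τ ζ s)⁻¹ * matK n α τ ζ s * (sqrtH n α τ ζ s)⁻¹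

/-- The entrywise derivative at `t` of a matrix-valued function of a real variable. -/
def matDeriv {m : Type*} (M : ℝ → Matrix m m ℂ) (t : ℝ) : Matrix m m ℂ :=
  Matrix.of fun i k => deriv (fun u => M u i k) t

/-- The number `(p, H^{1/2} d/dt(H^{-1/2} K H^{-1/2}) H^{1/2} p)` at the time `t`, where
`p = (p_0(η, ζ), …, p_n(η, ζ))` and `(x, y) = ∑ conj x_i y_i`. -/
def form (n : ℕ) (α : ℝ → ℕ → ℂ) (τ : ℝ → ℂ) (ζ s : ℂ) (p₀ : ℝ) (η : ℂ) (t : ℝ) : ℂ :=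
  star (pVec n (α t) (τ t) ζ s p₀ η) ⬝ᵥ
    ((sqrtH n (α t) (τ t) ζ s * matDeriv (fun u => matX n (α u) (τ u) ζ s) t *
      sqrtH n (α t) (τ t) ζ s).mulVec (pVec n (α t) (τ t) ζ s p₀ η))

/-- `θ` is a continuous argument, on the set `J` of times, of an eigenvalue `t ↦ exp (i θ(t))`
on the unit circle of the matrices `M t`. -/
def IsEigenArg {m : Type*} [Fintype m] [DecidableEq m] (M : ℝ → Matrix m m ℂ) (J : Set ℝ)
    (θ : ℝ → ℝ) : Prop :=
  ContinuousOn θ J ∧ ∀ t ∈ J, Complex.exp (θ t * Complex.I) ∈ spectrum ℂ (M t)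

end POPUC

end

/-!
The Szegő recursion gives explicit eigenvectors of `G`, and at any `z` the polynomials `p_{k+1}(z)`
are scalar multiples of paraorthogonal combinations of the Szegő pair at `z`. Hence `p_{n+1}(η) = 0`
at an eigenvalue `η`, and the three-term recurrence becomes `K p = c(η) H p` with the Cayley
transform `c(η) = i (η + ζ) / (η - ζ)`. So `H^{1/2} p` is an eigenvector of the Hermitian matrix
`X = H^{-1/2} K H^{-1/2}` for the eigenvalue `c(η)`, and first-order perturbation theory yields
`(p, H^{1/2} X' H^{1/2} p) = c(η)' (p, H p)`, where `c(η)' = -2 θ' / |η - ζ|²`.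
-/

noncomputable section

namespace POPUC

open Matrix Filter Set

/-! ### Matrices -/

section NormalMatrices

variable {𝕜 m : Type*} [RCLike 𝕜] [Fintype m] {M : Matrix m m 𝕜} {x : m → 𝕜} {z : 𝕜}

theorem exists_mulVec_eq_smul_iff_mem_spectrum {K : Type*} [Field K] [DecidableEq m]
    {M : Matrix m m K} {z : K} : (∃ x ≠ 0, M *ᵥ x = z • x) ↔ z ∈ spectrum K M := by
  rw [← Matrix.spectrum_toLin', ← Module.End.hasEigenvalue_iff_mem_spectrum,
    Module.End.HasEigenvalue, Module.End.HasUnifEigenvalue, Submodule.ne_bot_iff]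
  simp [and_comm]

theorem conjTranspose_mulVec_eq_zero_iff (hM : IsStarNormal M) :
    Mᴴ *ᵥ x = 0 ↔ M *ᵥ x = 0 := by
  have hcomm : Mᴴ * M = M * Mᴴ := hM.star_comm_self
  rw [← self_mul_conjTranspose_mulVec_eq_zero, ← hcomm, conjTranspose_mul_self_mulVec_eq_zero]

theorem conjTranspose_mulVec_eq_star_smul (hM : IsStarNormal M) (hx : M *ᵥ x = z • x) :
    Mᴴ *ᵥ x = star z • x := by
  classical
  have hN : IsStarNormal (M - algebraMap 𝕜 _ z) := ⟨by
    rw [star_sub, ← algebraMap_star_comm]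
    exact (hM.star_comm_self.sub_right (Algebra.commute_algebraMap_right _ _)).sub_left
      (Algebra.commute_algebraMap_left _ _)⟩
  have h := (conjTranspose_mulVec_eq_zero_iff (x := x) hN).2
    (by rw [Algebra.algebraMap_eq_smul_one, sub_mulVec, smul_mulVec, one_mulVec, hx, sub_self])
  rwa [Algebra.algebraMap_eq_smul_one, conjTranspose_sub, conjTranspose_smul, conjTranspose_one,
    sub_mulVec, smul_mulVec, one_mulVec, sub_eq_zero] at h

theorem star_dotProduct_mulVec_of_isStarNormal (hM : IsStarNormal M) (hx : M *ᵥ x = z • x)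
    (y : m → 𝕜) : star x ⬝ᵥ (M *ᵥ y) = z * (star x ⬝ᵥ y) := by
  have h := conjTranspose_mulVec_eq_star_smul hM hx
  rw [dotProduct_mulVec, ← conjTranspose_conjTranspose M, ← star_mulVec, h, star_smul, star_star,
    smul_dotProduct, smul_eq_mul]

end NormalMatrices

section SquareRoot

variable {𝕜 m E : Type*} [RCLike 𝕜] [NormedAddCommGroup E] [NormedSpace ℝ E]

theorem differentiableAt_matrix_iff [Finite m] {M : E → Matrix m m 𝕜} {t : E} :
    DifferentiableAt ℝ M t ↔ ∀ i k, DifferentiableAt ℝ (fun u => M u i k) t := by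
  have := Fintype.ofFinite m
  exact differentiableAt_pi.trans (forall_congr' fun i => differentiableAt_pi)

variable [Fintype m]

theorem eq_zero_of_posDef_mul_add_mul {R Z : Matrix m m 𝕜} (hR : R.PosDef)
    (h : R * Z + Z * R = 0) : Z = 0 := by
  classical
  have hpos₁ : (Zᴴ * R * Z).PosSemidef := hR.posSemidef.conjTranspose_mul_mul_same Z
  have hpos₂ : (Z * R * Zᴴ).PosSemidef := hR.posSemidef.mul_mul_conjTranspose_same Z
  have htrace : (Zᴴ * R * Z).trace + (Z * R * Zᴴ).trace = 0 := by
    rw [trace_mul_comm (Z * R), Matrix.mul_assoc, ← trace_add, ← Matrix.mul_add, h]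
    simp
  have hzero : Zᴴ * R * Z = 0 := hpos₁.trace_eq_zero_iff.1
    ((add_eq_zero_iff_of_nonneg hpos₁.trace_nonneg hpos₂.trace_nonneg).1 htrace).1
  refine ext_of_mulVec_single fun i => ?_
  by_contra hx
  rw [zero_mulVec] at hx
  have hlt := hR.dotProduct_mulVec_pos hx
  rw [star_mulVec, ← dotProduct_mulVec, mulVec_mulVec, mulVec_mulVec, hzero] at hlt
  simp at hlt

open scoped Classical in
theorem posDef_sqrt {M : Matrix m m 𝕜} (hM : M.PosDef) : (CFC.sqrt M).PosDef :=
  open scoped Matrix.Norms.L2Operator in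
  isStrictlyPositive_iff_posDef.1 (isStrictlyPositive_iff_posDef.2 hM).sqrt

open scoped Classical in
theorem sqrt_mul_sqrt_of_posDef {M : Matrix m m 𝕜} (hM : M.PosDef) :
    CFC.sqrt M * CFC.sqrt M = M :=
  CFC.sqrt_mul_sqrt_self M (nonneg_iff_posSemidef.2 hM.posSemidef)

open scoped Matrix.Norms.L2Operator in
theorem exists_hasStrictFDerivAt_mul_self {R : Matrix m m ℂ} (hR : R.PosDef) :
    ∃ e : Matrix m m ℂ ≃L[ℝ] Matrix m m ℂ, HasStrictFDerivAt (fun Z : Matrix m m ℂ => Z * Z)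
      (e : Matrix m m ℂ →L[ℝ] Matrix m m ℂ) R := by
  classical
  let L : Matrix m m ℂ →ₗ[ℝ] Matrix m m ℂ := LinearMap.mulLeft ℝ R + LinearMap.mulRight ℝ R
  have hL : Function.Injective L := (injective_iff_map_eq_zero L).2 fun Z hZ =>
    eq_zero_of_posDef_mul_add_mul hR (by simpa [L] using hZ)
  refine ⟨(LinearEquiv.ofInjectiveEndo L hL).toContinuousLinearEquiv, ?_⟩
  refine ((hasStrictFDerivAt_id (𝕜 := ℝ) R).mul' (hasStrictFDerivAt_id (𝕜 := ℝ) R)).congr_fderiv ?_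
  ext1 Z
  simp [L]

open scoped Classical Matrix.Norms.L2Operator in
theorem differentiableAt_sqrt_of_posDef {M : E → Matrix m m ℂ} {t : E}
    (hM : DifferentiableAt ℝ M t) (hpos : ∀ᶠ u in 𝓝 t, (M u).PosDef) :
    DifferentiableAt ℝ (fun u => CFC.sqrt (M u)) t := by
  have ht : (M t).PosDef := hpos.self_of_nhds
  obtain ⟨e, hsq⟩ := exists_hasStrictFDerivAt_mul_self (posDef_sqrt ht)
  have hcont : ContinuousAt (fun u => CFC.sqrt (M u)) t :=
    (CFC.continuousOn_sqrt (A := Matrix m m ℂ) (M t)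
      (nonneg_iff_posSemidef.2 ht.posSemidef)).tendsto.comp
      (tendsto_nhdsWithin_iff.2 ⟨hM.continuousAt,
        hpos.mono fun u hu => nonneg_iff_posSemidef.2 hu.posSemidef⟩)
  have hinv := hsq.to_localInverse.hasFDerivAt.differentiableAt
  simp only [sqrt_mul_sqrt_of_posDef ht] at hinv
  refine (hinv.comp t hM).congr_of_eventuallyEq ?_
  filter_upwards [hpos, hcont.eventually hsq.eventually_left_inverse] with u hu hleft
  rw [sqrt_mul_sqrt_of_posDef hu] at hleft
  exact hleft.symm

end SquareRoot

section Eigenvalues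

variable {𝕜 m : Type*} [RCLike 𝕜] [Fintype m]

theorem hasDerivAt_eigenvalue {M : ℝ → Matrix m m 𝕜} {M' : Matrix m m 𝕜} {x : ℝ → m → 𝕜}
    {l : ℝ → 𝕜} {t : ℝ} (hM : HasDerivAt M M' t) (hnormal : IsStarNormal (M t))
    (hx : ContinuousAt x t) (hne : x t ≠ 0) (heig : ∀ᶠ u in 𝓝 t, M u *ᵥ x u = l u • x u) :
    HasDerivAt l ((star (x t) ⬝ᵥ (M' *ᵥ x t)) / (star (x t) ⬝ᵥ x t)) t := by
  have hpair : star (x t) ⬝ᵥ x t ≠ 0 := fun h => hne (dotProduct_star_self_eq_zero.1 h)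
  have hpair_tendsto : Tendsto (fun u => star (x t) ⬝ᵥ x u) (𝓝 t) (𝓝 (star (x t) ⬝ᵥ x t)) :=
    ((continuous_const.dotProduct continuous_id).tendsto _).comp hx
  have hM_slope : Tendsto (slope M t) (𝓝[≠] t) (𝓝 M') :=
    (hasDerivAt_iff_tendsto_slope (F := m → m → 𝕜)).1 hM
  rw [hasDerivAt_iff_tendsto_slope]
  have hslope : Tendsto (fun u => (star (x t) ⬝ᵥ (slope M t u *ᵥ x u)) / (star (x t) ⬝ᵥ x u))
      (𝓝[≠] t) (𝓝 ((star (x t) ⬝ᵥ (M' *ᵥ x t)) / (star (x t) ⬝ᵥ x t))) := by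
    have hcont : Continuous fun q : Matrix m m 𝕜 × (m → 𝕜) => star (x t) ⬝ᵥ (q.1 *ᵥ q.2) := by
      fun_prop
    exact ((hcont.tendsto (M', x t)).comp
      (hM_slope.prodMk_nhds (hx.mono_left nhdsWithin_le_nhds))).div
        (hpair_tendsto.mono_left nhdsWithin_le_nhds) hpair
  refine hslope.congr' ?_
  filter_upwards [(heig.and (hpair_tendsto.eventually_ne hpair)).filter_mono nhdsWithin_le_nhds]
    with u ⟨hu, hpair_u⟩
  have ht : M t *ᵥ x t = l t • x t := heig.self_of_nhds
  rw [div_eq_iff hpair_u, slope_def_module, slope_def_module, smul_mulVec, sub_mulVec,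
    dotProduct_smul, dotProduct_sub, hu, dotProduct_smul, smul_eq_mul,
    star_dotProduct_mulVec_of_isStarNormal hnormal ht, ← sub_mul, smul_mul_assoc]

variable [DecidableEq m]

theorem pow_card_le_norm_eval_charpoly {K : Type*} [NormedField K] [IsAlgClosed K]
    {M : Matrix m m K} {z : K} {ε : ℝ} (hε : 0 ≤ ε) (h : ∀ w ∈ spectrum K M, ε ≤ ‖z - w‖) :
    ε ^ Fintype.card m ≤ ‖M.charpoly.eval z‖ := by
  have hsplits := IsAlgClosed.splits M.charpoly
  have hcard : M.charpoly.roots.card = Fintype.card m := by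
    rw [← hsplits.natDegree_eq_card_roots, charpoly_natDegree_eq_dim]
  rw [hsplits.eval_eq_prod_roots_of_monic (charpoly_monic _), ← hcard]
  calc ε ^ M.charpoly.roots.card
      = (M.charpoly.roots.map fun _ => ε).prod := by
        rw [Multiset.map_const', Multiset.prod_replicate]
    _ ≤ (M.charpoly.roots.map fun w => ‖z - w‖).prod :=
        Multiset.prod_map_le_prod_map₀ _ _ (fun _ _ => hε) fun w hw =>
          h w (mem_spectrum_iff_isRoot_charpoly.2 (Polynomial.isRoot_of_mem_roots hw))
    _ = ‖(M.charpoly.roots.map fun w => z - w).prod‖ := by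
        rw [← normHom_apply, map_multiset_prod, Multiset.map_map]
        rfl

variable {X : Type*} [TopologicalSpace X] {x : X}

theorem continuousAt_eval_charpoly {R : Type*} [CommRing R] [TopologicalSpace R]
    [IsTopologicalRing R] {M : X → Matrix m m R} (hM : ContinuousAt M x) (z : R) :
    ContinuousAt (fun y => (M y).charpoly.eval z) x := by
  simp only [eval_charpoly]
  exact (continuous_id.matrix_det.tendsto _).comp (continuousAt_const.sub hM)

theorem eventually_notMem_spectrum {M : X → Matrix m m 𝕜} (hM : ContinuousAt M x) {z : 𝕜}
    (hz : z ∉ spectrum 𝕜 (M x)) : ∀ᶠ y in 𝓝 x, z ∉ spectrum 𝕜 (M y) := by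
  simp only [mem_spectrum_iff_isRoot_charpoly] at hz ⊢
  exact (continuousAt_eval_charpoly hM z).eventually_ne hz

theorem lowerHemicontinuousAt_spectrum {M : X → Matrix m m ℂ} (hM : ContinuousAt M x) :
    LowerHemicontinuousAt (fun y => spectrum ℂ (M y)) x := by
  rw [lowerHemicontinuousAt_iff]
  rintro V hV ⟨z, hz, hzV⟩
  obtain ⟨ε, hε, hball⟩ := Metric.isOpen_iff.1 hV z hzV
  have hsmall : ∀ᶠ y in 𝓝 x, ‖(M y).charpoly.eval z‖ < ε ^ Fintype.card m := by
    refine (continuousAt_eval_charpoly hM z).norm.eventually_lt continuousAt_const ?_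
    rw [show (M x).charpoly.eval z = 0 from mem_spectrum_iff_isRoot_charpoly.1 hz, norm_zero]
    positivity
  filter_upwards [hsmall] with y hy
  by_contra hempty
  refine hy.not_ge (pow_card_le_norm_eval_charpoly hε.le fun w hw => ?_)
  by_contra! hlt
  exact hempty ⟨w, hw, hball (by rwa [Metric.mem_ball, dist_comm, dist_eq_norm])⟩

end Eigenvalues

theorem exists_continuousOn_selection {X Y : Type*} [TopologicalSpace X] [TopologicalSpace Y]
    {S : X → Set Y} {U : Set X} {V : Set Y} {x₀ : X} {y₀ : Y} (hU : IsOpen U) (hV : IsOpen V)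
    (hS : ∀ x ∈ U, LowerHemicontinuousAt S x) (hsub : ∀ x ∈ U, (S x ∩ V).Subsingleton)
    (hx₀ : x₀ ∈ U) (hy₀ : y₀ ∈ S x₀ ∩ V) :
    ∃ U' ⊆ U, IsOpen U' ∧ x₀ ∈ U' ∧ ∃ η : X → Y, ContinuousOn η U' ∧ η x₀ = y₀ ∧
      ∀ x ∈ U', η x ∈ S x ∩ V := by
  set U' : Set X := {x ∈ U | (S x ∩ V).Nonempty}
  have hx₀' : x₀ ∈ U' := ⟨hx₀, y₀, hy₀⟩
  have hU' : IsOpen U' := isOpen_iff_mem_nhds.2 fun x hx =>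
    (hU.eventually_mem hx.1).and (lowerHemicontinuousAt_iff.1 (hS x hx.1) V hV hx.2)
  have hchoice : ∀ x, ∃ y, x ∈ U' → y ∈ S x ∩ V := fun x => by
    by_cases hx : x ∈ U'
    · exact hx.2.imp fun y hy _ => hy
    · exact ⟨y₀, fun h => absurd h hx⟩
  choose η hη using hchoice
  refine ⟨U', sep_subset _ _, hU', hx₀', η, fun x hx => ContinuousAt.continuousWithinAt ?_,
    hsub x₀ hx₀ (hη x₀ hx₀') hy₀, hη⟩
  refine fun W hW => mem_map.2 ?_
  obtain ⟨W', hW'W, hW'open, hηW'⟩ := mem_nhds_iff.1 hW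
  have hmeets := lowerHemicontinuousAt_iff.1 (hS x hx.1) (W' ∩ V) (hW'open.inter hV)
    ⟨η x, (hη x hx).1, hηW', (hη x hx).2⟩
  filter_upwards [hmeets, hU'.eventually_mem hx] with x' ⟨y, hyS, hyW', hyV⟩ hx'
  exact hW'W (hsub x' hx'.1 (hη x' hx') ⟨hyS, hyV⟩ ▸ hyW')

/-! ### The unitary Hessenberg matrix -/

/-- The restriction `(f 0, …, f n)` of a sequence to the index set of the matrices; sequences
indexed by `ℕ` avoid casts in the recursions. -/
@[simp]
def trunc (n : ℕ) (f : ℕ → ℂ) (i : Fin (n + 1)) : ℂ := f i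

/-- Admissible parameters of `matG n α τ`: the Verblunsky coefficients `α 0, …, α (n - 1)` lie in
the open unit disc and `τ` lies on the unit circle. -/
structure IsVerblunsky (n : ℕ) (α : ℕ → ℂ) (τ : ℂ) : Prop where
  norm_alpha_lt : ∀ j < n, ‖α j‖ < 1
  norm_tau_last : ‖τ‖ = 1

theorem mul_conj_eq_one {z : ℂ} (hz : ‖z‖ = 1) : z * conj z = 1 := by
  simp [Complex.mul_conj', hz]

theorem rho_sq {a : ℂ} (ha : ‖a‖ < 1) : (rho a : ℂ) ^ 2 = 1 - a * conj a := by
  rw [rho, ← Complex.ofReal_pow, Real.sq_sqrt (by nlinarith [norm_nonneg a]), Complex.mul_conj']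
  push_cast
  rfl

theorem rho_pos {a : ℂ} (ha : ‖a‖ < 1) : 0 < rho a :=
  Real.sqrt_pos.2 (by nlinarith [norm_nonneg a])

theorem rho_ne_zero {a : ℂ} (ha : ‖a‖ < 1) : (rho a : ℂ) ≠ 0 :=
  Complex.ofReal_ne_zero.2 (rho_pos ha).ne'

theorem rho_conj (a : ℂ) : rho (conj a) = rho a := by simp [rho]

section Action

variable {n j : ℕ}

theorem givens_mulVec (hj : j < n) (a : ℂ) (f : ℕ → ℂ) :
    givens n j a *ᵥ trunc n f = trunc n fun i =>
      if i = j then conj a * f j + rho a * f (j + 1)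
      else if i = j + 1 then rho a * f j - a * f (j + 1) else f i := by
  funext i
  by_cases hi : (i : ℕ) = j ∨ (i : ℕ) = j + 1
  · have hsupp : ∀ c : Fin (n + 1), c ≠ ⟨j, by omega⟩ ∧ c ≠ ⟨j + 1, by omega⟩ →
        givens n j a i c * trunc n f c = 0 := by
      rintro c ⟨hc, hc'⟩
      simp only [ne_eq, Fin.ext_iff] at hc hc'
      have hic : i ≠ c := fun h => by subst h; omega
      simp [givens, hc, hc', hic]
    rw [mulVec, dotProduct, Fintype.sum_eq_add _ _ (by simp) hsupp]
    obtain hi | hi := hi <;> simp [givens, hi, sub_eq_add_neg]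
  · rw [not_or] at hi
    simp [mulVec, dotProduct, givens, hi]

theorem lastFactor_mulVec (τ : ℂ) (f : ℕ → ℂ) :
    lastFactor n τ *ᵥ trunc n f = trunc n fun i => if i = n then conj τ * f i else f i := by
  funext i
  simp only [lastFactor, mulVec_diagonal, ite_mul, one_mul, trunc]

theorem givens_conjTranspose (a : ℂ) : (givens n j a)ᴴ = givens n j (conj a) := by
  ext r c
  by_cases hrc : r = c
  · subst hrc
    simp only [conjTranspose_apply, givens, of_apply, rho_conj]
    split_ifs <;> first | omega | simp
  · have hval : (r : ℕ) ≠ c := Fin.val_ne_of_ne hrc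
    simp only [conjTranspose_apply, givens, of_apply, rho_conj, hrc, Ne.symm hrc, if_false]
    split_ifs <;> first | omega | simp

theorem givens_mem_unitaryGroup (hj : j < n) {a : ℂ} (ha : ‖a‖ < 1) :
    givens n j a ∈ unitaryGroup (Fin (n + 1)) ℂ := by
  have hinv : ∀ f : ℕ → ℂ, givens n j (conj a) *ᵥ (givens n j a *ᵥ trunc n f) = trunc n f := by
    intro f
    have hrho := rho_sq ha
    rw [givens_mulVec hj, givens_mulVec hj]
    funext i
    by_cases hij : (i : ℕ) = j
    · simp only [trunc, hij, if_true, rho_conj, Complex.conj_conj, Nat.succ_ne_self, if_false]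
      linear_combination f j * hrho
    by_cases hij' : (i : ℕ) = j + 1
    · simp only [trunc, hij', if_true, rho_conj, Nat.succ_ne_self, if_false]
      linear_combination f (j + 1) * hrho
    · simp only [trunc, hij, hij', if_false]
  rw [mem_unitaryGroup_iff', star_eq_conjTranspose, givens_conjTranspose]
  refine ext_of_mulVec_single fun k => ?_
  have hsingle : Pi.single k 1 = trunc n fun i => if i = k then (1 : ℂ) else 0 := by
    funext i
    simp [Pi.single_apply, Fin.ext_iff]
  rw [hsingle, ← mulVec_mulVec, hinv, one_mulVec]

theorem lastFactor_mem_unitaryGroup {τ : ℂ} (hτ : ‖τ‖ = 1) :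
    lastFactor n τ ∈ unitaryGroup (Fin (n + 1)) ℂ := by
  rw [mem_unitaryGroup_iff', star_eq_conjTranspose, lastFactor, diagonal_conjTranspose,
    diagonal_mul_diagonal, ← diagonal_one]
  congr 1
  funext i
  by_cases hi : (i : ℕ) = n <;> simp [hi, mul_conj_eq_one hτ]

theorem IsVerblunsky.matG_mem_unitaryGroup {α : ℕ → ℂ} {τ : ℂ} (h : IsVerblunsky n α τ) :
    matG n α τ ∈ unitaryGroup (Fin (n + 1)) ℂ := by
  refine mul_mem (list_prod_mem fun M hM => ?_) (lastFactor_mem_unitaryGroup h.norm_tau_last)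
  obtain ⟨j, hj, rfl⟩ := List.mem_map.1 hM
  exact givens_mem_unitaryGroup (List.mem_range.1 hj) (h.norm_alpha_lt j (List.mem_range.1 hj))

theorem IsVerblunsky.isStarNormal_matG {α : ℕ → ℂ} {τ : ℂ} (h : IsVerblunsky n α τ) :
    IsStarNormal (matG n α τ) :=
  isStarNormal_of_mem_unitary h.matG_mem_unitaryGroup

theorem IsVerblunsky.norm_eq_one_of_mem_spectrum {α : ℕ → ℂ} {τ z : ℂ}
    (h : IsVerblunsky n α τ) (hz : z ∈ spectrum ℂ (matG n α τ)) : ‖z‖ = 1 :=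
  open scoped Matrix.Norms.L2Operator in
  spectrum.norm_eq_one_of_unitary h.matG_mem_unitaryGroup hz

theorem IsVerblunsky.ne_zero_of_mem_spectrum {α : ℕ → ℂ} {τ z : ℂ}
    (h : IsVerblunsky n α τ) (hz : z ∈ spectrum ℂ (matG n α τ)) : z ≠ 0 :=
  norm_ne_zero_iff.1 (by rw [h.norm_eq_one_of_mem_spectrum hz]; exact one_ne_zero)

end Action

section Sweep

variable {n : ℕ} {α x u : ℕ → ℂ} {τ : ℂ}

/-- The vector `G_k ⋯ G_n x`, where `u j` is the entry at `j` of `G_j ⋯ G_n x`. -/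
def sweep (α x u : ℕ → ℂ) (k i : ℕ) : ℂ :=
  if i < k then x i else if i = k then u k else rho (α (i - 1)) * x (i - 1) - α (i - 1) * u i

theorem givens_mulVec_sweep_succ {k : ℕ} (hk : k < n)
    (hu : u k = conj (α k) * x k + rho (α k) * u (k + 1)) :
    givens n k (α k) *ᵥ trunc n (sweep α x u (k + 1)) = trunc n (sweep α x u k) := by
  rw [givens_mulVec hk]
  funext i
  rcases lt_trichotomy (i : ℕ) k with hi | hi | hi
  · simp [sweep, hi, hi.ne, hi.le, show (i : ℕ) ≠ k + 1 by omega]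
  · simp [sweep, hi, hu]
  · by_cases hi' : (i : ℕ) = k + 1
    · simp [sweep, hi']
    · simp [sweep, hi.ne', hi', hi.not_ge, hi.not_gt]

theorem matG_mulVec (hn : u n = conj τ * x n)
    (hu : ∀ j < n, u j = conj (α j) * x j + rho (α j) * u (j + 1)) :
    matG n α τ *ᵥ trunc n x = trunc n (sweep α x u 0) := by
  have hprod : ∀ k ≤ n, ((List.range k).map fun j => givens n j (α j)).prod *ᵥ
      trunc n (sweep α x u k) = trunc n (sweep α x u 0) := by
    intro k hk
    induction k with
    | zero => simp
    | succ k ih =>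
      rw [List.range_succ, List.map_append, List.prod_append, ← mulVec_mulVec, List.map_singleton,
        List.prod_singleton, givens_mulVec_sweep_succ hk (hu k hk), ih (by omega)]
  rw [matG, ← mulVec_mulVec, lastFactor_mulVec, ← hprod n le_rfl]
  congr 1
  funext i
  by_cases hi : (i : ℕ) = n
  · simp [sweep, hi, hn]
  · simp [sweep, hi, show (i : ℕ) < n by omega]

theorem matG_zero_row (α : ℕ → ℂ) (τ : ℂ) (c : Fin (n + 1)) :
    matG n α τ 0 c = (∏ i ∈ Finset.range c, (rho (α i) : ℂ)) *
      (if (c : ℕ) = n then conj τ else conj (α c)) := by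
  set γ : ℂ := if (c : ℕ) = n then conj τ else conj (α c)
  have h := matG_mulVec (n := n) (α := α) (τ := τ) (x := fun i => if i = (c : ℕ) then 1 else 0)
    (u := fun j => if j ≤ (c : ℕ) then (∏ i ∈ Finset.Ico j c, (rho (α i) : ℂ)) * γ else 0) ?_ ?_
  · simpa [γ, sweep, mulVec, dotProduct, ← Fin.ext_iff] using congrFun h 0
  · rcases (Nat.lt_succ_iff.1 c.2).eq_or_lt with hc | hc
    · simp [γ, hc]
    · simp [hc.ne', show ¬ n ≤ (c : ℕ) by omega]
  · intro j hj
    rcases lt_trichotomy j (c : ℕ) with hjc | hjc | hjc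
    · simp only [hjc.le, if_true, hjc.ne, if_false, mul_zero, zero_add, Nat.succ_le_of_lt hjc]
      rw [Finset.prod_eq_prod_Ico_succ_bot hjc, mul_assoc]
    · simp [γ, ← hjc, hj.ne]
    · simp [hjc.ne', show ¬ j ≤ (c : ℕ) by omega, show ¬ j + 1 ≤ (c : ℕ) by omega]

theorem exists_backward_recursion {X : Type*} (n : ℕ) (a : X) (f : ℕ → X → X) :
    ∃ u : ℕ → X, u n = a ∧ ∀ j < n, u j = f j (u (j + 1)) := by
  induction n generalizing f with
  | zero => exact ⟨fun _ => a, rfl, by simp⟩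
  | succ n ih =>
    obtain ⟨u, hun, hu⟩ := ih fun j => f (j + 1)
    refine ⟨fun | 0 => f 0 (u 0) | j + 1 => u j, hun, fun j hj => ?_⟩
    cases j with
    | zero => rfl
    | succ j => exact hu j (by omega)

end Sweep

section Szego

variable {n : ℕ} {α : ℕ → ℂ} {τ z : ℂ}

/-- The normalised Szegő recursion `(z φ_k(z), φ_k^*(z)) / z ^ k`. Its second components are the
entries of an eigenvector of `G` with first entry `1`. -/
def szego (α : ℕ → ℂ) (z : ℂ) : ℕ → ℂ × ℂ
  | 0 => (z, 1)
  | k + 1 => (((szego α z k).1 - conj (α k) * (szego α z k).2) / rho (α k),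
      ((szego α z k).2 - α k * (szego α z k).1) / (z * rho (α k)))

/-- The value at `z` of the paraorthogonal polynomial with boundary value `b`, in the
normalisation of `szego`. -/
def paraSzego (α : ℕ → ℂ) (b z : ℂ) (k : ℕ) : ℂ := (szego α z k).1 - b * (szego α z k).2

/-- The candidate for an eigenvector of `G` with eigenvalue `z`. -/
def eigenvector (n : ℕ) (α : ℕ → ℂ) (z : ℂ) : Fin (n + 1) → ℂ := trunc n fun k => (szego α z k).2

theorem eigenvector_ne_zero (n : ℕ) (α : ℕ → ℂ) (z : ℂ) : eigenvector n α z ≠ 0 :=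
  fun h => one_ne_zero (α := ℂ) (congrFun h 0)

theorem szego_fst_eq {k : ℕ} (hα : ‖α k‖ < 1) :
    (szego α z k).1 = conj (α k) * (szego α z k).2 + rho (α k) * (szego α z (k + 1)).1 := by
  rw [szego, mul_div_cancel₀ _ (rho_ne_zero hα)]
  ring

theorem mul_szego_succ_snd {k : ℕ} (hα : ‖α k‖ < 1) (hz : z ≠ 0) :
    z * (szego α z (k + 1)).2 = rho (α k) * (szego α z k).2 - α k * (szego α z (k + 1)).1 := by
  have hρ := rho_ne_zero hα
  simp only [szego]
  field_simp
  linear_combination -(szego α z k).2 * rho_sq hα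

theorem matG_mulVec_eigenvector (hα : ∀ j < n, ‖α j‖ < 1) (hz : z ≠ 0)
    (h : paraSzego α (conj τ) z n = 0) :
    matG n α τ *ᵥ eigenvector n α z = z • eigenvector n α z := by
  rw [eigenvector, matG_mulVec (u := fun k => (szego α z k).1) (sub_eq_zero.1 h)
    fun j hj => szego_fst_eq (hα j hj)]
  funext i
  obtain ⟨i, hi⟩ := i
  cases i with
  | zero => simp [sweep, szego]
  | succ k => simpa [sweep] using (mul_szego_succ_snd (hα k (by omega)) hz).symm

theorem eq_mul_szego {x u : ℕ → ℂ} (hα : ∀ j < n, ‖α j‖ < 1) (hz : z ≠ 0)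
    (hu : ∀ j < n, u j = conj (α j) * x j + rho (α j) * u (j + 1)) (hu0 : u 0 = z * x 0)
    (hx : ∀ j < n, rho (α j) * x j - α j * u (j + 1) = z * x (j + 1)) {k : ℕ} (hk : k ≤ n) :
    u k = x 0 * (szego α z k).1 ∧ x k = x 0 * (szego α z k).2 := by
  induction k with
  | zero => simp [szego, hu0, mul_comm]
  | succ k ih =>
    obtain ⟨ihu, ihx⟩ := ih (by omega)
    have hρ := rho_ne_zero (hα k hk)
    have hfst := szego_fst_eq (z := z) (hα k hk)
    have hsnd := mul_szego_succ_snd (hα k hk) hz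
    have hu_succ : u (k + 1) = x 0 * (szego α z (k + 1)).1 := by
      apply mul_left_cancel₀ hρ
      linear_combination ihu - hu k hk + x 0 * hfst - conj (α k) * ihx
    refine ⟨hu_succ, mul_left_cancel₀ hz ?_⟩
    linear_combination rho (α k) * ihx - hx k hk - x 0 * hsnd - α k * hu_succ

theorem mem_spectrum_matG_iff (hα : ∀ j < n, ‖α j‖ < 1) (hz : z ≠ 0) :
    z ∈ spectrum ℂ (matG n α τ) ↔ paraSzego α (conj τ) z n = 0 := by
  rw [← exists_mulVec_eq_smul_iff_mem_spectrum]
  refine ⟨?_, fun h => ⟨_, eigenvector_ne_zero n α z, matG_mulVec_eigenvector hα hz h⟩⟩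
  rintro ⟨y, hy, heig⟩
  obtain ⟨x, rfl⟩ : ∃ x, trunc n x = y :=
    ⟨fun k => y (Fin.ofNat (n + 1) k), by funext i; simp⟩
  obtain ⟨u, hun, hu⟩ := exists_backward_recursion n (conj τ * x n)
    fun j v => conj (α j) * x j + rho (α j) * v
  rw [matG_mulVec hun hu] at heig
  have hk : ∀ k ≤ n, u k = x 0 * (szego α z k).1 ∧ x k = x 0 * (szego α z k).2 := fun k hk =>
    eq_mul_szego hα hz hu (by simpa [sweep] using congrFun heig 0)
      (fun j hj => by simpa [sweep] using congrFun heig ⟨j + 1, by omega⟩) hk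
  have hx0 : x 0 ≠ 0 := fun h0 => hy (funext fun i => by
    simp [trunc, (hk i (Nat.lt_succ_iff.1 i.2)).2, h0])
  refine (mul_eq_zero.1 (?_ : x 0 * paraSzego α (conj τ) z n = 0)).resolve_left hx0
  rw [paraSzego]
  linear_combination hun - (hk n le_rfl).1 + conj τ * (hk n le_rfl).2

theorem IsVerblunsky.matG_mulVec_eigenvector_of_mem_spectrum (h : IsVerblunsky n α τ)
    (hz : z ∈ spectrum ℂ (matG n α τ)) :
    matG n α τ *ᵥ eigenvector n α z = z • eigenvector n α z :=
  matG_mulVec_eigenvector h.norm_alpha_lt (h.ne_zero_of_mem_spectrum hz)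
    ((mem_spectrum_matG_iff h.norm_alpha_lt (h.ne_zero_of_mem_spectrum hz)).1 hz)

end Szego

/-! ### Pseudoreflection coefficients and the polynomials `p_k` -/

section Pencil

variable {n : ℕ} {α : ℕ → ℂ} {τ ζ s z : ℂ} {k : ℕ}

theorem conj_mul_add_conj_ne_zero {a b c : ℂ} (ha : ‖a‖ < 1) (hb : ‖b‖ = 1) (hc : ‖c‖ = 1) :
    conj a * b + conj c ≠ 0 := fun h => by
  have hnorm : ‖conj a * b‖ = ‖conj c‖ := by rw [eq_neg_of_add_eq_zero_left h, norm_neg]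
  rw [norm_mul, RCLike.norm_conj, RCLike.norm_conj, hb, hc, mul_one] at hnorm
  exact ha.ne hnorm

theorem norm_blaschke_eq_one {a b c : ℂ} (ha : ‖a‖ < 1) (hb : ‖b‖ = 1) (hc : ‖c‖ = 1) :
    ‖(conj c * a + b) / (conj a * b + conj c)‖ = 1 := by
  have hnum : conj c * a + b = conj c * b * conj (conj a * b + conj c) := by
    simp only [map_add, map_mul, Complex.conj_conj]
    linear_combination (-conj c * a) * mul_conj_eq_one hb - b * mul_conj_eq_one hc
  rw [norm_div, hnum, norm_mul, norm_mul, RCLike.norm_conj, RCLike.norm_conj, hb, hc, one_mul,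
    one_mul, div_self (norm_ne_zero_iff.2 (conj_mul_add_conj_ne_zero ha hb hc))]

theorem IsVerblunsky.norm_tau (h : IsVerblunsky n α τ) (hζ : ‖ζ‖ = 1) (j : ℕ) :
    ‖tau n α τ ζ j‖ = 1 := by
  rw [tau]
  have hle : n - j ≤ n := Nat.sub_le _ _
  generalize n - j = k at hle
  induction k with
  | zero => exact h.norm_tau_last
  | succ k ih => exact norm_blaschke_eq_one (h.norm_alpha_lt _ (by omega)) (ih (by omega)) hζ

theorem IsVerblunsky.tau_mul_conj (h : IsVerblunsky n α τ) (hζ : ‖ζ‖ = 1) (j : ℕ) :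
    tau n α τ ζ j * conj (tau n α τ ζ j) = 1 :=
  mul_conj_eq_one (h.norm_tau hζ j)

/-- The factor `1 - conj τ_k(ζ) α_k` of the recursion for `β`. -/
def gap (n : ℕ) (α : ℕ → ℂ) (τ ζ : ℂ) (k : ℕ) : ℂ := 1 - conj (tau n α τ ζ k) * α k

theorem IsVerblunsky.gap_ne_zero (h : IsVerblunsky n α τ) (hζ : ‖ζ‖ = 1) (hk : k < n) :
    gap n α τ ζ k ≠ 0 := fun h0 => by
  have hnorm : ‖conj (tau n α τ ζ k) * α k‖ = 1 := by rw [← sub_eq_zero.1 h0, norm_one]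
  rw [norm_mul, RCLike.norm_conj, h.norm_tau hζ, one_mul] at hnorm
  exact (h.norm_alpha_lt k hk).ne hnorm

theorem IsVerblunsky.conj_gap_ne_zero (h : IsVerblunsky n α τ) (hζ : ‖ζ‖ = 1) (hk : k < n) :
    conj (gap n α τ ζ k) ≠ 0 :=
  (map_ne_zero _).2 (h.gap_ne_zero hζ hk)

theorem IsVerblunsky.conj_tau_succ_mul_gap (h : IsVerblunsky n α τ) (hζ : ‖ζ‖ = 1) (hk : k < n) :
    conj (tau n α τ ζ (k + 1)) * gap n α τ ζ k = ζ * (conj (tau n α τ ζ k) - conj (α k)) := by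
  have hrec := tau_of_lt n α τ ζ k hk
  rw [eq_div_iff (conj_mul_add_conj_ne_zero (h.norm_alpha_lt k hk) (h.norm_tau hζ _) hζ)] at hrec
  replace hrec := congrArg conj hrec
  simp only [map_mul, map_add, Complex.conj_conj] at hrec
  rw [gap]
  linear_combination -hrec

theorem IsVerblunsky.conj_tau_mul_conj_gap (h : IsVerblunsky n α τ) (hζ : ‖ζ‖ = 1) (k : ℕ) :
    conj (tau n α τ ζ k) * conj (gap n α τ ζ k) = conj (tau n α τ ζ k) - conj (α k) := by
  simp only [gap, map_sub, map_one, map_mul, Complex.conj_conj]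
  linear_combination (-conj (α k)) * h.tau_mul_conj hζ k

theorem IsVerblunsky.gap_add_conj_gap (h : IsVerblunsky n α τ) (hζ : ‖ζ‖ = 1) (hk : k < n) :
    gap n α τ ζ k + conj (gap n α τ ζ k) =
      (rho (α k) : ℂ) ^ 2 + gap n α τ ζ k * conj (gap n α τ ζ k) := by
  simp only [gap, map_sub, map_one, map_mul, Complex.conj_conj]
  linear_combination (-α k * conj (α k)) * h.tau_mul_conj hζ k - rho_sq (h.norm_alpha_lt k hk)

theorem IsVerblunsky.conj_add_tau_mul_conj_gap (h : IsVerblunsky n α τ) (hζ : ‖ζ‖ = 1)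
    (hk : k < n) : (conj ζ + tau n α τ ζ (k + 1) * conj (α k)) * conj (gap n α τ ζ k) =
      conj ζ * (rho (α k) : ℂ) ^ 2 := by
  have hconj := congrArg conj (h.conj_tau_succ_mul_gap hζ hk)
  simp only [map_mul, map_sub, Complex.conj_conj] at hconj
  rw [rho_sq (h.norm_alpha_lt k hk)]
  have hgap : conj (gap n α τ ζ k) = 1 - tau n α τ ζ k * conj (α k) := by simp [gap]
  linear_combination conj (α k) * hconj + conj ζ * hgap

theorem IsVerblunsky.rho_mul_paraSzego (h : IsVerblunsky n α τ) (hζ : ‖ζ‖ = 1) (hz : z ≠ 0)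
    (hk : k < n) :
    rho (α k) * paraSzego α (conj (tau n α τ ζ k)) z k =
      gap n α τ ζ k * paraSzego α (z * conj ζ * conj (tau n α τ ζ (k + 1))) z (k + 1) := by
  have hα := h.norm_alpha_lt k hk
  have hρ := rho_ne_zero hα
  have hζ' := mul_conj_eq_one hζ
  have hτ := h.conj_tau_succ_mul_gap hζ hk
  have hgap : gap n α τ ζ k = 1 - conj (tau n α τ ζ k) * α k := rfl
  simp only [paraSzego, szego]
  field_simp
  linear_combination ((szego α z k).1 - conj (tau n α τ ζ k) * (szego α z k).2) * rho_sq hα -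
    ((szego α z k).1 - conj (α k) * (szego α z k).2) * hgap +
    conj ζ * ((szego α z k).2 - α k * (szego α z k).1) * hτ +
    (conj (tau n α τ ζ k) - conj (α k)) * ((szego α z k).2 - α k * (szego α z k).1) * hζ'

theorem IsVerblunsky.mul_rho_mul_gap_mul_paraSzego_succ (h : IsVerblunsky n α τ) (hζ : ‖ζ‖ = 1)
    (hz : z ≠ 0) (hk : k < n) :
    z * rho (α k) * gap n α τ ζ k * paraSzego α (conj (tau n α τ ζ (k + 1))) z (k + 1) =
      (ζ * conj (gap n α τ ζ k) + z * gap n α τ ζ k) * paraSzego α (conj (tau n α τ ζ k)) z k -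
        ζ * gap n α τ ζ k * conj (gap n α τ ζ k) *
          paraSzego α (z * conj ζ * conj (tau n α τ ζ k)) z k := by
  have hα := h.norm_alpha_lt k hk
  have hρ := rho_ne_zero hα
  have hζ' := mul_conj_eq_one hζ
  have hτ := h.conj_tau_succ_mul_gap hζ hk
  have hτ' := h.conj_tau_mul_conj_gap hζ k
  have hadd := h.gap_add_conj_gap hζ hk
  have hgap : gap n α τ ζ k = 1 - conj (tau n α τ ζ k) * α k := rfl
  simp only [paraSzego, szego]
  field_simp
  linear_combination (-((szego α z k).2 - α k * (szego α z k).1)) * hτ +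
    ζ * (szego α z k).1 * (hgap - hadd - rho_sq hα) +
    (ζ - z * gap n α τ ζ k) * (szego α z k).2 * hτ' -
    z * gap n α τ ζ k * (szego α z k).2 * conj (tau n α τ ζ k) * conj (gap n α τ ζ k) * hζ'

/-- At `z = ζ` the two boundary values of `rho_mul_paraSzego` coincide, so that all the values
`paraSzego α (conj τ_k) ζ k` vanish as soon as the first one, `ζ - conj τ_0`, does. -/
theorem IsVerblunsky.conj_sub_tau_zero_ne_zero (h : IsVerblunsky n α τ) (hζ : ‖ζ‖ = 1)
    (hS : ζ ∉ spectrum ℂ (matG n α τ)) : conj ζ - tau n α τ ζ 0 ≠ 0 := by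
  intro h0
  have hζ0 : ζ ≠ 0 := left_ne_zero_of_mul_eq_one (mul_conj_eq_one hζ)
  have hvanish : ∀ k ≤ n, paraSzego α (conj (tau n α τ ζ k)) ζ k = 0 := by
    intro k hk
    induction k with
    | zero => simp [paraSzego, szego, ← sub_eq_zero.1 h0]
    | succ k ih =>
      have hstep := h.rho_mul_paraSzego hζ hζ0 (k := k) (by omega)
      rw [ih (by omega), mul_zero, mul_conj_eq_one hζ, one_mul] at hstep
      exact (mul_eq_zero.1 hstep.symm).resolve_left (h.gap_ne_zero hζ (by omega))
  exact hS ((mem_spectrum_matG_iff h.norm_alpha_lt hζ0).2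
    (by simpa only [tau_last] using hvanish n le_rfl))

/-- The positive numbers `c_k` for which `β_{k+1} = ζ^{1/2} c_k / (1 - conj τ_k(ζ) α_k)`. -/
def scale (n : ℕ) (α : ℕ → ℂ) (τ ζ : ℂ) : ℕ → ℝ
  | 0 => 1
  | k + 1 => ‖gap n α τ ζ k‖ ^ 2 / (scale n α τ ζ k * rho (α k) ^ 2)

theorem IsVerblunsky.scale_pos (h : IsVerblunsky n α τ) (hζ : ‖ζ‖ = 1) (hk : k ≤ n) :
    0 < scale n α τ ζ k := by
  induction k with
  | zero => exact one_pos
  | succ k ih =>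
    have hgap := norm_pos_iff.2 (h.gap_ne_zero hζ (k := k) (by omega))
    have hρ := rho_pos (h.norm_alpha_lt k (by omega))
    have hscale := ih (by omega)
    rw [scale]
    positivity

theorem IsVerblunsky.scale_ne_zero (h : IsVerblunsky n α τ) (hζ : ‖ζ‖ = 1) (hk : k ≤ n) :
    (scale n α τ ζ k : ℂ) ≠ 0 :=
  Complex.ofReal_ne_zero.2 (h.scale_pos hζ hk).ne'

theorem IsVerblunsky.scale_mul_scale_succ (h : IsVerblunsky n α τ) (hζ : ‖ζ‖ = 1) (hk : k < n) :
    (scale n α τ ζ k : ℂ) * scale n α τ ζ (k + 1) * (rho (α k) : ℂ) ^ 2 =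
      gap n α τ ζ k * conj (gap n α τ ζ k) := by
  have hρ := (rho_pos (h.norm_alpha_lt k hk)).ne'
  have hscale := (h.scale_pos hζ hk.le).ne'
  rw [Complex.mul_conj, Complex.normSq_eq_norm_sq, scale]
  norm_cast
  field_simp

theorem norm_eq_one_of_sq_eq (hζ : ‖ζ‖ = 1) (hs : s ^ 2 = ζ) : ‖s‖ = 1 := by
  rw [← hs, norm_pow] at hζ
  exact (pow_eq_one_iff_of_nonneg (norm_nonneg s) two_ne_zero).1 hζ

theorem conj_mul_eq_of_sq_eq (hζ : ‖ζ‖ = 1) (hs : s ^ 2 = ζ) : conj s * ζ = s := by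
  rw [← hs]
  linear_combination s * mul_conj_eq_one (norm_eq_one_of_sq_eq hζ hs)

theorem mul_conj_eq_of_sq_eq (hζ : ‖ζ‖ = 1) (hs : s ^ 2 = ζ) : s * conj ζ = conj s := by
  simpa using congrArg conj (conj_mul_eq_of_sq_eq hζ hs)

theorem beta_zero_eq (hζ : ‖ζ‖ = 1) (hs : s ^ 2 = ζ) :
    beta n α τ ζ s 0 = 1 / (s * (conj ζ - tau n α τ ζ 0)) := by
  rw [beta, ← hs, map_pow]
  congr 1
  linear_combination (-conj s) * mul_conj_eq_one (norm_eq_one_of_sq_eq hζ hs)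

theorem IsVerblunsky.beta_succ_eq (h : IsVerblunsky n α τ) (hζ : ‖ζ‖ = 1) (hs : s ^ 2 = ζ)
    (hS : ζ ∉ spectrum ℂ (matG n α τ)) (hk : k < n) :
    beta n α τ ζ s (k + 1) = s * scale n α τ ζ k / gap n α τ ζ k := by
  have hs0 : s ≠ 0 := left_ne_zero_of_mul_eq_one (mul_conj_eq_one (norm_eq_one_of_sq_eq hζ hs))
  have hgap := h.gap_ne_zero hζ hk
  rw [beta, ← gap]
  induction k with
  | zero =>
    have h0 := h.conj_sub_tau_zero_ne_zero hζ hS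
    rw [beta_zero_eq hζ hs, if_pos rfl, map_neg, map_one, mul_neg_one, ← sub_eq_add_neg, scale]
    field_simp
    norm_num
  | succ k ih =>
    have hgap' := h.gap_ne_zero hζ (k := k) (by omega)
    have hgap_conj := h.conj_gap_ne_zero hζ (k := k) (by omega)
    have hρ := rho_ne_zero (h.norm_alpha_lt k (by omega))
    have hscale := h.scale_ne_zero hζ (k := k) (by omega)
    have hζs : s ^ 2 * conj ζ = 1 := by rw [hs, mul_conj_eq_one hζ]
    have hζc : conj ζ ≠ 0 := right_ne_zero_of_mul_eq_one hζs
    have hτ : conj ζ + tau n α τ ζ (k + 1) * conj (α k) =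
        conj ζ * (rho (α k) : ℂ) ^ 2 / conj (gap n α τ ζ k) :=
      eq_div_of_mul_eq hgap_conj (h.conj_add_tau_mul_conj_gap hζ (by omega))
    rw [beta, ← gap, ih (by omega) hgap', if_neg k.succ_ne_zero, Nat.add_sub_cancel, hτ]
    field_simp
    rw [← h.scale_mul_scale_succ hζ (by omega)]
    linear_combination (-scale n α τ ζ k * scale n α τ ζ (k + 1) * (rho (α k) : ℂ) ^ 2) * hζs

theorem conj_beta_zero_eq (hζ : ‖ζ‖ = 1) (hs : s ^ 2 = ζ) :
    conj (beta n α τ ζ s 0) = 1 / (conj s * (ζ - conj (tau n α τ ζ 0))) := by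
  simp [beta_zero_eq hζ hs]

theorem IsVerblunsky.beta_zero_eq_neg_mul_conj (h : IsVerblunsky n α τ) (hζ : ‖ζ‖ = 1)
    (hs : s ^ 2 = ζ) (hS : ζ ∉ spectrum ℂ (matG n α τ)) :
    beta n α τ ζ s 0 = -conj (tau n α τ ζ 0) * conj (beta n α τ ζ s 0) := by
  have hss := mul_conj_eq_one (norm_eq_one_of_sq_eq hζ hs)
  have hs0 : s ≠ 0 := left_ne_zero_of_mul_eq_one hss
  have hs0' : conj s ≠ 0 := right_ne_zero_of_mul_eq_one hss
  have h0 := h.conj_sub_tau_zero_ne_zero hζ hS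
  have h0' : ζ - conj (tau n α τ ζ 0) ≠ 0 := by simpa using (map_ne_zero (starRingEnd ℂ)).2 h0
  rw [conj_beta_zero_eq hζ hs, beta_zero_eq hζ hs]
  field_simp
  linear_combination conj_mul_eq_of_sq_eq hζ hs +
    conj (tau n α τ ζ 0) * mul_conj_eq_of_sq_eq hζ hs - s * h.tau_mul_conj hζ 0

theorem IsVerblunsky.mul_conj_beta_zero_mul (h : IsVerblunsky n α τ) (hζ : ‖ζ‖ = 1)
    (hs : s ^ 2 = ζ) (hS : ζ ∉ spectrum ℂ (matG n α τ)) :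
    s * conj (beta n α τ ζ s 0) * (1 - conj ζ * conj (tau n α τ ζ 0)) = 1 := by
  have hs0 : conj s ≠ 0 :=
    right_ne_zero_of_mul_eq_one (mul_conj_eq_one (norm_eq_one_of_sq_eq hζ hs))
  have h0 : ζ - conj (tau n α τ ζ 0) ≠ 0 := by
    simpa using (map_ne_zero (starRingEnd ℂ)).2 (h.conj_sub_tau_zero_ne_zero hζ hS)
  rw [conj_beta_zero_eq hζ hs]
  field_simp
  linear_combination -conj_mul_eq_of_sq_eq hζ hs -
    conj (tau n α τ ζ 0) * mul_conj_eq_of_sq_eq hζ hs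

theorem IsVerblunsky.exists_pVal_eq_mul_paraSzego (h : IsVerblunsky n α τ) (hζ : ‖ζ‖ = 1)
    (hs : s ^ 2 = ζ) (hS : ζ ∉ spectrum ℂ (matG n α τ)) (p₀ : ℝ) (hz : z ≠ 0) (hk : k ≤ n) :
    ∃ q : ℂ, pVal (beta n α τ ζ s) p₀ z (k + 1) = q * paraSzego α (conj (tau n α τ ζ k)) z k ∧
      z * pVal (beta n α τ ζ s) p₀ z k =
        s * scale n α τ ζ k * q * paraSzego α (z * conj ζ * conj (tau n α τ ζ k)) z k := by
  induction k with
  | zero =>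
    refine ⟨p₀ * conj (beta n α τ ζ s 0), ?_, ?_⟩
    · simp only [pVal, paraSzego, szego]
      linear_combination (p₀ : ℂ) * h.beta_zero_eq_neg_mul_conj hζ hs hS
    · simp only [pVal, paraSzego, szego, scale]
      push_cast
      linear_combination (-z * p₀ : ℂ) * h.mul_conj_beta_zero_mul hζ hs hS
  | succ k ih =>
    obtain ⟨q, hp_succ, hp⟩ := ih (by omega)
    have hgap := h.gap_ne_zero hζ (k := k) (by omega)
    have hgap_conj := h.conj_gap_ne_zero hζ (k := k) (by omega)
    have hW := h.rho_mul_paraSzego hζ hz (k := k) (by omega)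
    have hW' := h.mul_rho_mul_gap_mul_paraSzego_succ hζ hz (k := k) (by omega)
    have hscale := h.scale_mul_scale_succ hζ (k := k) (by omega)
    have hss := mul_conj_eq_one (norm_eq_one_of_sq_eq hζ hs)
    have hβ := h.beta_succ_eq hζ hs hS (k := k) (by omega)
    refine ⟨q * (z * rho (α k) * conj (beta n α τ ζ s (k + 1))), ?_, ?_⟩
    · rw [pVal, hp, hp_succ, hβ]
      simp only [map_div₀, map_mul, Complex.conj_ofReal]
      field_simp
      linear_combination (-scale n α τ ζ k * q * conj s : ℂ) * hW' -
        scale n α τ ζ k * q * conj (gap n α τ ζ k) *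
          (paraSzego α (conj (tau n α τ ζ k)) z k - gap n α τ ζ k *
            paraSzego α (z * conj ζ * conj (tau n α τ ζ k)) z k) * conj_mul_eq_of_sq_eq hζ hs
    · rw [hp_succ, hβ]
      simp only [map_div₀, map_mul, Complex.conj_ofReal]
      field_simp
      apply mul_left_cancel₀ hgap
      linear_combination
        q * s * conj s * scale n α τ ζ k * scale n α τ ζ (k + 1) * rho (α k) * hW -
          q * paraSzego α (conj (tau n α τ ζ k)) z k *
            (s * conj s * hscale + gap n α τ ζ k * conj (gap n α τ ζ k) * hss)

theorem IsVerblunsky.pVal_succ_eq_zero (h : IsVerblunsky n α τ) (hζ : ‖ζ‖ = 1)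
    (hs : s ^ 2 = ζ) (hS : ζ ∉ spectrum ℂ (matG n α τ)) (p₀ : ℝ)
    (hz : z ∈ spectrum ℂ (matG n α τ)) : pVal (beta n α τ ζ s) p₀ z (n + 1) = 0 := by
  have hz0 := h.ne_zero_of_mem_spectrum hz
  obtain ⟨q, hq, -⟩ := h.exists_pVal_eq_mul_paraSzego hζ hs hS p₀ hz0 le_rfl
  rw [hq, tau_last, (mem_spectrum_matG_iff h.norm_alpha_lt hz0).1 hz, mul_zero]

theorem IsVerblunsky.mul_conj_beta_zero_add (h : IsVerblunsky n α τ) (hζ : ‖ζ‖ = 1)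
    (hs : s ^ 2 = ζ) (hS : ζ ∉ spectrum ℂ (matG n α τ)) :
    s * conj (beta n α τ ζ s 0) + conj s * beta n α τ ζ s 0 = 1 := by
  linear_combination conj s * h.beta_zero_eq_neg_mul_conj hζ hs hS +
    h.mul_conj_beta_zero_mul hζ hs hS +
    conj (beta n α τ ζ s 0) * conj (tau n α τ ζ 0) * mul_conj_eq_of_sq_eq hζ hs

theorem IsVerblunsky.mul_conj_beta_succ_add (h : IsVerblunsky n α τ) (hζ : ‖ζ‖ = 1)
    (hs : s ^ 2 = ζ) (hS : ζ ∉ spectrum ℂ (matG n α τ)) (hk : k < n) :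
    s * conj (beta n α τ ζ s (k + 1)) + conj s * beta n α τ ζ s (k + 1) =
      (scale n α τ ζ (k + 1) : ℂ)⁻¹ + scale n α τ ζ k := by
  have hss := mul_conj_eq_one (norm_eq_one_of_sq_eq hζ hs)
  have hgap := h.gap_ne_zero hζ hk
  have hgap_conj := h.conj_gap_ne_zero hζ hk
  have hc' := h.scale_ne_zero hζ (k := k + 1) hk
  have hscale := h.scale_mul_scale_succ hζ hk
  have hadd := h.gap_add_conj_gap hζ hk
  rw [h.beta_succ_eq hζ hs hS hk]
  simp only [map_div₀, map_mul, Complex.conj_ofReal]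
  field_simp
  linear_combination scale n α τ ζ k * scale n α τ ζ (k + 1) *
    ((gap n α τ ζ k + conj (gap n α τ ζ k)) * hss + hadd) + hscale

end Pencil

/-! ### The Hermitian pencil -/

section LowerShift

variable {n : ℕ}

/-- The lower shift matrix, with ones on the subdiagonal; it is the off-diagonal part of
`matA` up to a factor. -/
def lowerShift (n : ℕ) : Matrix (Fin (n + 1)) (Fin (n + 1)) ℂ :=
  Matrix.of fun i k => if (i : ℕ) = k + 1 then 1 else 0

theorem lowerShift_mulVec_zero (v : Fin (n + 1) → ℂ) : (lowerShift n *ᵥ v) 0 = 0 := by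
  simp [lowerShift, mulVec, dotProduct]

theorem lowerShift_mulVec_succ (v : Fin (n + 1) → ℂ) (i : Fin n) :
    (lowerShift n *ᵥ v) i.succ = v i.castSucc := by
  simp [lowerShift, mulVec, dotProduct, Fin.sum_univ_castSucc, ← Fin.ext_iff, i.2.ne]

theorem lowerShift_mulVec_trunc (f : ℕ → ℂ) :
    lowerShift n *ᵥ trunc n f = trunc n fun i => if i = 0 then 0 else f (i - 1) := by
  funext i
  cases i using Fin.cases <;> simp [lowerShift_mulVec_zero, lowerShift_mulVec_succ]

theorem conjTranspose_lowerShift_mulVec_trunc {f : ℕ → ℂ} (hf : f (n + 1) = 0) :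
    (lowerShift n)ᴴ *ᵥ trunc n f = trunc n fun i => f (i + 1) := by
  funext i
  have hsum : ((lowerShift n)ᴴ *ᵥ trunc n f) i =
      ∑ k ∈ Finset.range (n + 1), if k = (i : ℕ) + 1 then f k else 0 := by
    rw [← Fin.sum_univ_eq_sum_range (fun k => if k = (i : ℕ) + 1 then f k else 0)]
    simp [lowerShift, mulVec, dotProduct, apply_ite]
  rw [hsum, Finset.sum_ite_eq']
  split_ifs with hi
  · rfl
  · rw [Finset.mem_range] at hi
    rw [trunc, show (i : ℕ) + 1 = n + 1 by omega, hf]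

theorem lowerShift_mul_diagonal_mul_conjTranspose (c : ℕ → ℂ) :
    lowerShift n * diagonal (trunc n c) * (lowerShift n)ᴴ =
      diagonal (trunc n fun i => if i = 0 then 0 else c (i - 1)) := by
  ext i k
  have hentry : (lowerShift n * diagonal (trunc n c) * (lowerShift n)ᴴ) i k =
      (lowerShift n *ᵥ fun j => c j * conj (lowerShift n k j)) i := by
    simp only [mul_apply (N := (lowerShift n)ᴴ), mul_diagonal, conjTranspose_apply, trunc, mulVec,
      dotProduct, mul_assoc, RCLike.star_def]
  rw [hentry]
  cases i using Fin.cases with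
  | zero => simp [lowerShift_mulVec_zero, diagonal_apply]
  | succ i =>
    cases k using Fin.cases with
    | zero =>
      rw [lowerShift_mulVec_succ]
      simp [lowerShift]
    | succ k =>
      rw [lowerShift_mulVec_succ]
      simp [lowerShift, diagonal_apply, ← Fin.ext_iff, eq_comm]

end LowerShift

section Pencil

variable {n : ℕ} {α : ℕ → ℂ} {τ ζ s z : ℂ}

theorem matA_eq_smul_diagonal_sub_lowerShift (n : ℕ) (α : ℕ → ℂ) (τ ζ s : ℂ) :
    matA n α τ ζ s = s • (diagonal (trunc n fun i => conj (beta n α τ ζ s i)) - lowerShift n) := by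
  ext i k
  by_cases hik : i = k
  · simp [matA, lowerShift, hik]
  · by_cases hik' : (i : ℕ) = k + 1 <;> simp [matA, lowerShift, hik, hik']

theorem conjTranspose_matA (n : ℕ) (α : ℕ → ℂ) (τ ζ s : ℂ) :
    (matA n α τ ζ s)ᴴ = conj s • (diagonal (trunc n (beta n α τ ζ s)) - (lowerShift n)ᴴ) := by
  rw [matA_eq_smul_diagonal_sub_lowerShift, conjTranspose_smul, conjTranspose_sub,
    diagonal_conjTranspose]
  congr 3
  funext i
  simp

/-- The unit upper triangular factor `L` in `2 H = Lᴴ diag(1 / c_0, …, 1 / c_n) L`. -/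
def pencilFactor (n : ℕ) (α : ℕ → ℂ) (τ ζ s : ℂ) : Matrix (Fin (n + 1)) (Fin (n + 1)) ℂ :=
  1 - conj s • (diagonal (trunc n fun i => (scale n α τ ζ i : ℂ)) * (lowerShift n)ᴴ)

theorem det_pencilFactor (n : ℕ) (α : ℕ → ℂ) (τ ζ s : ℂ) : (pencilFactor n α τ ζ s).det = 1 := by
  rw [det_of_isUpperTriangular]
  · exact Finset.prod_eq_one fun i _ => by simp [pencilFactor, lowerShift]
  · intro i k hik
    replace hik : k < i := hik
    have hne : i ≠ k := hik.ne'
    have hne' : (k : ℕ) ≠ i + 1 := by omega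
    simp [pencilFactor, lowerShift, hne, hne']

theorem IsVerblunsky.mul_conj_beta_add (h : IsVerblunsky n α τ) (hζ : ‖ζ‖ = 1) (hs : s ^ 2 = ζ)
    (hS : ζ ∉ spectrum ℂ (matG n α τ)) {k : ℕ} (hk : k ≤ n) :
    s * conj (beta n α τ ζ s k) + conj s * beta n α τ ζ s k =
      (scale n α τ ζ k : ℂ)⁻¹ + if k = 0 then 0 else (scale n α τ ζ (k - 1) : ℂ) := by
  cases k with
  | zero => simpa [scale] using h.mul_conj_beta_zero_add hζ hs hS
  | succ k => simpa using h.mul_conj_beta_succ_add hζ hs hS hk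

theorem IsVerblunsky.conjTranspose_pencilFactor_mul_diagonal_mul (h : IsVerblunsky n α τ)
    (hζ : ‖ζ‖ = 1) (hs : s ^ 2 = ζ) :
    (pencilFactor n α τ ζ s)ᴴ * diagonal (trunc n fun i => (scale n α τ ζ i : ℂ)⁻¹) *
        pencilFactor n α τ ζ s =
      diagonal (trunc n fun i => (scale n α τ ζ i : ℂ)⁻¹) +
        lowerShift n * diagonal (trunc n fun i => (scale n α τ ζ i : ℂ)) * (lowerShift n)ᴴ -
        s • lowerShift n - conj s • (lowerShift n)ᴴ := by
  have hss := mul_conj_eq_one (norm_eq_one_of_sq_eq hζ hs)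
  set C := diagonal (trunc n fun i => (scale n α τ ζ i : ℂ)) with hC
  set D := diagonal (trunc n fun i => (scale n α τ ζ i : ℂ)⁻¹) with hD
  set N := lowerShift n
  have hscale : ∀ i : Fin (n + 1), (scale n α τ ζ i : ℂ) ≠ 0 := fun i =>
    h.scale_ne_zero hζ (Nat.lt_succ_iff.1 i.2)
  have hCstar : Cᴴ = C := by
    rw [hC, diagonal_conjTranspose]
    congr 1
    funext i
    simp
  have hCD : C * D = 1 := by simp [hC, hD, diagonal_mul_diagonal, hscale]
  have hDC : D * C = 1 := by simp [hC, hD, diagonal_mul_diagonal, hscale]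
  have hstar : (pencilFactor n α τ ζ s)ᴴ = 1 - s • (N * C) := by
    rw [pencilFactor, ← hC, conjTranspose_sub, conjTranspose_one, conjTranspose_smul,
      conjTranspose_mul, conjTranspose_conjTranspose, hCstar, RCLike.star_def, Complex.conj_conj]
  have hNCD : N * C * D = N := by rw [mul_assoc, hCD, mul_one]
  have hDCN : D * (C * Nᴴ) = Nᴴ := by rw [← mul_assoc, hDC, one_mul]
  rw [hstar, pencilFactor, ← hC, sub_mul, one_mul, smul_mul_assoc, hNCD, mul_sub, mul_one,
    mul_smul_comm, sub_mul, smul_mul_assoc, hDCN, smul_sub, smul_smul, mul_comm (conj s), hss,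
    one_smul, ← mul_assoc]
  abel

theorem IsVerblunsky.matA_add_conjTranspose (h : IsVerblunsky n α τ) (hζ : ‖ζ‖ = 1)
    (hs : s ^ 2 = ζ) (hS : ζ ∉ spectrum ℂ (matG n α τ)) :
    matA n α τ ζ s + (matA n α τ ζ s)ᴴ = (pencilFactor n α τ ζ s)ᴴ *
      diagonal (trunc n fun i => (scale n α τ ζ i : ℂ)⁻¹) * pencilFactor n α τ ζ s := by
  have hdiag : (diagonal fun i : Fin (n + 1) => trunc n (fun i => (scale n α τ ζ i : ℂ)⁻¹) i +
      trunc n (fun i => if i = 0 then 0 else (scale n α τ ζ (i - 1) : ℂ)) i) =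
      s • diagonal (trunc n fun i => conj (beta n α τ ζ s i)) +
        conj s • diagonal (trunc n (beta n α τ ζ s)) := by
    rw [← diagonal_smul, ← diagonal_smul, diagonal_add]
    congr 1
    funext i
    exact (h.mul_conj_beta_add hζ hs hS (Nat.lt_succ_iff.1 i.2)).symm
  rw [h.conjTranspose_pencilFactor_mul_diagonal_mul hζ hs,
    lowerShift_mul_diagonal_mul_conjTranspose, conjTranspose_matA,
    matA_eq_smul_diagonal_sub_lowerShift, diagonal_add, hdiag, smul_sub, smul_sub]
  abel

theorem IsVerblunsky.posDef_matH (h : IsVerblunsky n α τ) (hζ : ‖ζ‖ = 1) (hs : s ^ 2 = ζ)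
    (hS : ζ ∉ spectrum ℂ (matG n α τ)) : (matH n α τ ζ s).PosDef := by
  rw [matH, h.matA_add_conjTranspose hζ hs hS]
  have hdiag : (diagonal (trunc n fun i => (scale n α τ ζ i : ℂ)⁻¹)).PosDef :=
    PosDef.diagonal fun i => by
      have := h.scale_pos hζ (Nat.lt_succ_iff.1 i.2)
      rw [trunc, ← Complex.ofReal_inv, Complex.zero_lt_real]
      positivity
  refine (hdiag.conjTranspose_mul_mul_same (mulVec_injective_of_isUnit ?_)).smul (by norm_num)
  rw [isUnit_iff_isUnit_det, det_pencilFactor]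
  exact isUnit_one

theorem pVal_succ (β : ℕ → ℂ) (p₀ : ℝ) (z : ℂ) (k : ℕ) :
    pVal β p₀ z (k + 1) = (β k + conj (β k) * z) * pVal β p₀ z k -
      z * if k = 0 then 0 else pVal β p₀ z (k - 1) := by
  cases k <;> simp [pVal]

theorem pVec_ne_zero {p₀ : ℝ} (hp₀ : p₀ ≠ 0) : pVec n α τ ζ s p₀ z ≠ 0 := fun h =>
  hp₀ (by simpa [pVec, pVal] using congrFun h 0)

theorem conjTranspose_matA_mulVec_pVec (hζ : ‖ζ‖ = 1) (hs : s ^ 2 = ζ) {p₀ : ℝ}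
    (hp : pVal (beta n α τ ζ s) p₀ z (n + 1) = 0) :
    (matA n α τ ζ s)ᴴ *ᵥ pVec n α τ ζ s p₀ z =
      (-(z * conj ζ)) • (matA n α τ ζ s *ᵥ pVec n α τ ζ s p₀ z) := by
  have hss := mul_conj_eq_of_sq_eq hζ hs
  have hpVec : pVec n α τ ζ s p₀ z = trunc n (pVal (beta n α τ ζ s) p₀ z) := rfl
  funext i
  rw [conjTranspose_matA, matA_eq_smul_diagonal_sub_lowerShift, hpVec]
  simp only [smul_mulVec, sub_mulVec, conjTranspose_lowerShift_mulVec_trunc hp,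
    lowerShift_mulVec_trunc, mulVec_diagonal, Pi.smul_apply, Pi.sub_apply, smul_eq_mul, trunc,
    pVal_succ]
  linear_combination (z * (conj (beta n α τ ζ s i) * pVal (beta n α τ ζ s) p₀ z i -
    if (i : ℕ) = 0 then 0 else pVal (beta n α τ ζ s) p₀ z (i - 1))) * hss

/-- The Cayley transform with pole `ζ`; it maps the unit circle to the real line and turns
counterclockwise motion into decrease. -/
def cayley (ζ z : ℂ) : ℂ := Complex.I * (z + ζ) / (z - ζ)

theorem matK_mulVec_pVec (hζ : ‖ζ‖ = 1) (hs : s ^ 2 = ζ) {p₀ : ℝ}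
    (hp : pVal (beta n α τ ζ s) p₀ z (n + 1) = 0) (hzζ : z ≠ ζ) :
    matK n α τ ζ s *ᵥ pVec n α τ ζ s p₀ z =
      cayley ζ z • (matH n α τ ζ s *ᵥ pVec n α τ ζ s p₀ z) := by
  have hne := sub_ne_zero.2 hzζ
  have hI := Complex.I_ne_zero
  rw [matK, matH, smul_mulVec, smul_mulVec, sub_mulVec, add_mulVec,
    conjTranspose_matA_mulVec_pVec hζ hs hp, cayley]
  funext i
  simp only [Pi.smul_apply, Pi.sub_apply, Pi.add_apply, smul_eq_mul]
  field_simp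
  rw [Complex.I_sq]
  linear_combination
    (-2 * z * (matA n α τ ζ s *ᵥ pVec n α τ ζ s p₀ z) i) * mul_conj_eq_one hζ

theorem isHermitian_matK (n : ℕ) (α : ℕ → ℂ) (τ ζ s : ℂ) : (matK n α τ ζ s).IsHermitian := by
  have hstar : star (1 / (2 * Complex.I)) = -(1 / (2 * Complex.I)) := by simp
  rw [IsHermitian, matK, conjTranspose_smul, hstar, conjTranspose_sub, conjTranspose_conjTranspose,
    neg_smul, ← smul_neg, neg_sub]

theorem posDef_sqrtH (hH : (matH n α τ ζ s).PosDef) : (sqrtH n α τ ζ s).PosDef :=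
  posDef_sqrt hH

theorem sqrtH_mul_sqrtH (hH : (matH n α τ ζ s).PosDef) :
    sqrtH n α τ ζ s * sqrtH n α τ ζ s = matH n α τ ζ s :=
  sqrt_mul_sqrt_of_posDef hH

theorem isHermitian_sqrtH (n : ℕ) (α : ℕ → ℂ) (τ ζ s : ℂ) : (sqrtH n α τ ζ s).IsHermitian :=
  (nonneg_iff_posSemidef.1 (CFC.sqrt_nonneg _)).isHermitian

theorem isHermitian_matX (n : ℕ) (α : ℕ → ℂ) (τ ζ s : ℂ) : (matX n α τ ζ s).IsHermitian := by
  have hinv : ((sqrtH n α τ ζ s)⁻¹).IsHermitian := (isHermitian_sqrtH n α τ ζ s).inv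
  rw [IsHermitian, matX, conjTranspose_mul, conjTranspose_mul, hinv.eq,
    (isHermitian_matK n α τ ζ s).eq, Matrix.mul_assoc]

theorem matX_mulVec_sqrtH_mulVec (hH : (matH n α τ ζ s).PosDef) {p : Fin (n + 1) → ℂ} {l : ℂ}
    (hp : matK n α τ ζ s *ᵥ p = l • (matH n α τ ζ s *ᵥ p)) :
    matX n α τ ζ s *ᵥ (sqrtH n α τ ζ s *ᵥ p) = l • (sqrtH n α τ ζ s *ᵥ p) := by
  have hdet : IsUnit (sqrtH n α τ ζ s).det :=
    (isUnit_iff_isUnit_det _).1 (posDef_sqrtH hH).isUnit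
  rw [matX, mulVec_mulVec, Matrix.mul_assoc, nonsing_inv_mul _ hdet, Matrix.mul_one,
    ← mulVec_mulVec, hp, mulVec_smul, mulVec_mulVec, ← sqrtH_mul_sqrtH hH,
    nonsing_inv_mul_cancel_left _ _ hdet]

theorem IsVerblunsky.matX_mulVec_sqrtH_mulVec_pVec (h : IsVerblunsky n α τ) (hζ : ‖ζ‖ = 1)
    (hs : s ^ 2 = ζ) (hS : ζ ∉ spectrum ℂ (matG n α τ)) (p₀ : ℝ)
    (hz : z ∈ spectrum ℂ (matG n α τ)) :
    matX n α τ ζ s *ᵥ (sqrtH n α τ ζ s *ᵥ pVec n α τ ζ s p₀ z) =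
      cayley ζ z • (sqrtH n α τ ζ s *ᵥ pVec n α τ ζ s p₀ z) :=
  matX_mulVec_sqrtH_mulVec (h.posDef_matH hζ hs hS)
    (matK_mulVec_pVec hζ hs (h.pVal_succ_eq_zero hζ hs hS p₀ hz) fun hzζ => hS (hzζ ▸ hz))

end Pencil

/-! ### Differentiable families -/

section Differentiability

theorem differentiableAt_ofReal {E : Type*} [NormedAddCommGroup E] [NormedSpace ℝ E] {f : E → ℝ}
    {x : E} (hf : DifferentiableAt ℝ f x) : DifferentiableAt ℝ (fun y => (f y : ℂ)) x :=
  Complex.ofRealCLM.differentiableAt.comp x hf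

theorem differentiableAt_rho {E : Type*} [NormedAddCommGroup E] [NormedSpace ℝ E] {f : E → ℂ}
    {x : E} (hf : DifferentiableAt ℝ f x) (hlt : ‖f x‖ < 1) :
    DifferentiableAt ℝ (fun y => rho (f y)) x :=
  ((differentiableAt_const (1 : ℝ)).sub (hf.norm_sq ℝ)).sqrt (Real.sqrt_pos.1 (rho_pos hlt)).ne'

theorem differentiableAt_conjTranspose {E m : Type*} [NormedAddCommGroup E] [NormedSpace ℝ E]
    [Finite m] {M : E → Matrix m m ℂ} {x : E} (hM : DifferentiableAt ℝ M x) :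
    DifferentiableAt ℝ (fun y => (M y)ᴴ) x :=
  differentiableAt_matrix_iff.2 fun i k => (differentiableAt_matrix_iff.1 hM k i).star

variable {n : ℕ} {α : ℝ → ℕ → ℂ} {τ : ℝ → ℂ} {ζ s : ℂ} {t : ℝ} {k : ℕ}

/-- A family of matrices `matG` depending on a parameter, with admissible coefficients near `t`,
that is differentiable at `t`. Only the matrices are assumed to be differentiable, not the
coefficients. -/
structure IsDifferentiableFamilyAt (n : ℕ) (α : ℝ → ℕ → ℂ) (τ : ℝ → ℂ) (t : ℝ) : Prop where
  eventually_isVerblunsky : ∀ᶠ u in 𝓝 t, IsVerblunsky n (α u) (τ u)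
  differentiableAt_matG : DifferentiableAt ℝ (fun u => matG n (α u) (τ u)) t

namespace IsDifferentiableFamilyAt

theorem isVerblunsky (h : IsDifferentiableFamilyAt n α τ t) : IsVerblunsky n (α t) (τ t) :=
  h.eventually_isVerblunsky.self_of_nhds

/-- The first row of `G` consists of the coefficients, up to conjugation and nonzero factors that
depend on the preceding coefficients only. -/
theorem differentiableAt_ite (h : IsDifferentiableFamilyAt n α τ t) (hk : k ≤ n)
    (hα : ∀ j < k, DifferentiableAt ℝ (fun u => α u j) t) :
    DifferentiableAt ℝ (fun u => if k = n then τ u else α u k) t := by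
  have hprod_ne : ∀ u, IsVerblunsky n (α u) (τ u) →
      ∏ i ∈ Finset.range k, (rho (α u i) : ℂ) ≠ 0 := fun u hu =>
    Finset.prod_ne_zero_iff.2 fun i hi =>
      rho_ne_zero (hu.norm_alpha_lt i ((Finset.mem_range.1 hi).trans_le hk))
  have hprod : DifferentiableAt ℝ (fun u => ∏ i ∈ Finset.range k, (rho (α u i) : ℂ)) t :=
    DifferentiableAt.fun_finsetProd fun i hi =>
      differentiableAt_ofReal (differentiableAt_rho (hα i (Finset.mem_range.1 hi))
        (h.isVerblunsky.norm_alpha_lt i ((Finset.mem_range.1 hi).trans_le hk)))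
  have hentry := differentiableAt_matrix_iff.1 h.differentiableAt_matG 0 ⟨k, Nat.lt_succ_of_le hk⟩
  rw [← differentiableAt_star_iff]
  refine (hentry.fun_div hprod (hprod_ne t h.isVerblunsky)).congr_of_eventuallyEq ?_
  filter_upwards [h.eventually_isVerblunsky] with u hu
  rw [matG_zero_row, mul_div_cancel_left₀ _ (hprod_ne u hu), apply_ite star]
  rfl

theorem differentiableAt_alpha (h : IsDifferentiableFamilyAt n α τ t) (hk : k < n) :
    DifferentiableAt ℝ (fun u => α u k) t := by
  induction k using Nat.strong_induction_on with
  | _ k ih =>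
    simpa only [hk.ne, if_false] using
      h.differentiableAt_ite hk.le fun j hj => ih j hj (hj.trans hk)

theorem differentiableAt_last (h : IsDifferentiableFamilyAt n α τ t) : DifferentiableAt ℝ τ t := by
  simpa only [if_true] using h.differentiableAt_ite le_rfl fun _ hj => h.differentiableAt_alpha hj

theorem differentiableAt_tau (h : IsDifferentiableFamilyAt n α τ t) (hζ : ‖ζ‖ = 1) (hk : k ≤ n) :
    DifferentiableAt ℝ (fun u => tau n (α u) (τ u) ζ k) t := by
  induction hk using Nat.decreasingInduction with
  | self => simpa only [tau_last] using h.differentiableAt_last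
  | of_succ k hk ih =>
    have hα := h.differentiableAt_alpha hk
    have hne := conj_mul_add_conj_ne_zero (h.isVerblunsky.norm_alpha_lt k hk)
      (h.isVerblunsky.norm_tau hζ (k + 1)) hζ
    simp only [tau_of_lt _ _ _ _ k hk]
    fun_prop (disch := exact hne)

theorem differentiableAt_gap (h : IsDifferentiableFamilyAt n α τ t) (hζ : ‖ζ‖ = 1) (hk : k < n) :
    DifferentiableAt ℝ (fun u => gap n (α u) (τ u) ζ k) t :=
  (differentiableAt_const _).sub
    ((h.differentiableAt_tau hζ hk.le).star.mul (h.differentiableAt_alpha hk))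

theorem differentiableAt_scale (h : IsDifferentiableFamilyAt n α τ t) (hζ : ‖ζ‖ = 1)
    (hk : k ≤ n) : DifferentiableAt ℝ (fun u => scale n (α u) (τ u) ζ k) t := by
  induction k with
  | zero => exact differentiableAt_const _
  | succ k ih =>
    have hlt := h.isVerblunsky.norm_alpha_lt k hk
    have hnum := (h.differentiableAt_gap hζ hk).norm_sq ℝ
    have hscale := ih (Nat.le_of_succ_le hk)
    have hrho := differentiableAt_rho (h.differentiableAt_alpha hk) hlt
    have hne := (mul_pos (h.isVerblunsky.scale_pos hζ (Nat.le_of_succ_le hk))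
      (pow_pos (rho_pos hlt) 2)).ne'
    simp only [scale]
    fun_prop (disch := exact hne)

theorem eventually_notMem_spectrum_matG (h : IsDifferentiableFamilyAt n α τ t)
    (hS : ζ ∉ spectrum ℂ (matG n (α t) (τ t))) :
    ∀ᶠ u in 𝓝 t, ζ ∉ spectrum ℂ (matG n (α u) (τ u)) :=
  eventually_notMem_spectrum h.differentiableAt_matG.continuousAt hS

theorem differentiableAt_beta (h : IsDifferentiableFamilyAt n α τ t) (hζ : ‖ζ‖ = 1)
    (hs : s ^ 2 = ζ) (hS : ζ ∉ spectrum ℂ (matG n (α t) (τ t))) (hk : k ≤ n) :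
    DifferentiableAt ℝ (fun u => beta n (α u) (τ u) ζ s k) t := by
  cases k with
  | zero =>
    have hs0 : s ≠ 0 := left_ne_zero_of_mul_eq_one (mul_conj_eq_one (norm_eq_one_of_sq_eq hζ hs))
    have hne := mul_ne_zero hs0 (h.isVerblunsky.conj_sub_tau_zero_ne_zero hζ hS)
    have hτ := h.differentiableAt_tau hζ (Nat.zero_le n)
    simp only [beta_zero_eq hζ hs]
    fun_prop (disch := exact hne)
  | succ k =>
    have hscale := differentiableAt_ofReal (h.differentiableAt_scale hζ (Nat.le_of_succ_le hk))
    have hgap := h.differentiableAt_gap hζ hk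
    have hne := h.isVerblunsky.gap_ne_zero hζ hk
    refine ((hscale.const_mul s).fun_div hgap hne).congr_of_eventuallyEq ?_
    filter_upwards [h.eventually_isVerblunsky, h.eventually_notMem_spectrum_matG hS] with u hu hSu
    exact hu.beta_succ_eq hζ hs hSu hk

theorem differentiableAt_matA (h : IsDifferentiableFamilyAt n α τ t) (hζ : ‖ζ‖ = 1)
    (hs : s ^ 2 = ζ) (hS : ζ ∉ spectrum ℂ (matG n (α t) (τ t))) :
    DifferentiableAt ℝ (fun u => matA n (α u) (τ u) ζ s) t := by
  refine differentiableAt_matrix_iff.2 fun i k => ?_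
  have hβ := h.differentiableAt_beta hζ hs hS (Nat.lt_succ_iff.1 i.2)
  simp only [matA, Matrix.smul_apply, of_apply]
  split_ifs
  · exact hβ.star.const_smul s
  · exact differentiableAt_const _
  · exact differentiableAt_const _

open scoped Matrix.Norms.L2Operator in
theorem differentiableAt_matH (h : IsDifferentiableFamilyAt n α τ t) (hζ : ‖ζ‖ = 1)
    (hs : s ^ 2 = ζ) (hS : ζ ∉ spectrum ℂ (matG n (α t) (τ t))) :
    DifferentiableAt ℝ (fun u => matH n (α u) (τ u) ζ s) t :=
  have hA := h.differentiableAt_matA hζ hs hS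
  (hA.fun_add (differentiableAt_conjTranspose hA)).fun_const_smul (1 / 2 : ℂ)

open scoped Matrix.Norms.L2Operator in
theorem differentiableAt_matK (h : IsDifferentiableFamilyAt n α τ t) (hζ : ‖ζ‖ = 1)
    (hs : s ^ 2 = ζ) (hS : ζ ∉ spectrum ℂ (matG n (α t) (τ t))) :
    DifferentiableAt ℝ (fun u => matK n (α u) (τ u) ζ s) t :=
  have hA := h.differentiableAt_matA hζ hs hS
  (hA.fun_sub (differentiableAt_conjTranspose hA)).fun_const_smul (1 / (2 * Complex.I))

theorem differentiableAt_sqrtH (h : IsDifferentiableFamilyAt n α τ t) (hζ : ‖ζ‖ = 1)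
    (hs : s ^ 2 = ζ) (hS : ζ ∉ spectrum ℂ (matG n (α t) (τ t))) :
    DifferentiableAt ℝ (fun u => sqrtH n (α u) (τ u) ζ s) t :=
  differentiableAt_sqrt_of_posDef (h.differentiableAt_matH hζ hs hS)
    ((h.eventually_isVerblunsky.and (h.eventually_notMem_spectrum_matG hS)).mono
      fun _ hu => hu.1.posDef_matH hζ hs hu.2)

open scoped Matrix.Norms.L2Operator in
theorem differentiableAt_matX (h : IsDifferentiableFamilyAt n α τ t) (hζ : ‖ζ‖ = 1)
    (hs : s ^ 2 = ζ) (hS : ζ ∉ spectrum ℂ (matG n (α t) (τ t))) :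
    DifferentiableAt ℝ (fun u => matX n (α u) (τ u) ζ s) t := by
  have hunit : IsUnit (sqrtH n (α t) (τ t) ζ s) :=
    (posDef_sqrtH (h.isVerblunsky.posDef_matH hζ hs hS)).isUnit
  have hinv : DifferentiableAt ℝ (fun u => (sqrtH n (α u) (τ u) ζ s)⁻¹) t := by
    simp only [nonsing_inv_eq_ringInverse]
    exact (differentiableAt_inverse hunit).comp t (h.differentiableAt_sqrtH hζ hs hS)
  exact (hinv.mul (h.differentiableAt_matK hζ hs hS)).mul hinv

end IsDifferentiableFamilyAt

end Differentiability

section Continuity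

variable {X : Type*} [TopologicalSpace X] {n : ℕ} {a : X → ℕ → ℂ} {z : X → ℂ} {x : X} {k : ℕ}

theorem continuous_rho : Continuous rho := by
  unfold rho
  fun_prop

theorem continuousAt_szego (hz : ContinuousAt z x) (hz0 : z x ≠ 0)
    (ha : ∀ j < k, ContinuousAt (fun y => a y j) x) (ha_lt : ∀ j < k, ‖a x j‖ < 1) :
    ContinuousAt (fun y => szego (a y) (z y) k) x := by
  induction k with
  | zero => exact hz.prodMk continuousAt_const
  | succ k ih =>
    have hszego := ih (fun j hj => ha j (by omega)) fun j hj => ha_lt j (by omega)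
    have hak := ha k k.lt_succ_self
    have hρ : ContinuousAt (fun y => (rho (a y k) : ℂ)) x :=
      (Complex.continuous_ofReal.comp continuous_rho).continuousAt.comp hak
    have hρ0 := rho_ne_zero (ha_lt k k.lt_succ_self)
    exact ((hszego.fst.sub ((Complex.continuous_conj.continuousAt.comp hak).mul hszego.snd)).div
      hρ hρ0).prodMk ((hszego.snd.sub (hak.mul hszego.fst)).div (hz.mul hρ) (mul_ne_zero hz0 hρ0))

theorem continuousAt_eigenvector (hz : ContinuousAt z x) (hz0 : z x ≠ 0)
    (ha : ∀ j < n, ContinuousAt (fun y => a y j) x) (ha_lt : ∀ j < n, ‖a x j‖ < 1) :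
    ContinuousAt (fun y => eigenvector n (a y) (z y)) x :=
  continuousAt_pi.2 fun i => (continuousAt_szego hz hz0 (fun j hj => ha j (by omega))
    fun j hj => ha_lt j (by omega)).snd

theorem continuousAt_pVal {β : X → ℕ → ℂ} (hz : ContinuousAt z x) (p₀ : ℝ)
    (hβ : ∀ j < k, ContinuousAt (fun y => β y j) x) :
    ContinuousAt (fun y => pVal (β y) p₀ (z y) k) x := by
  have hfactor : ∀ j < k, ContinuousAt (fun y => β y j + conj (β y j) * z y) x := fun j hj =>
    (hβ j hj).add ((Complex.continuous_conj.continuousAt.comp (hβ j hj)).mul hz)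
  clear hβ
  induction k using Nat.twoStepInduction with
  | zero => exact continuousAt_const
  | one => exact (hfactor 0 one_pos).mul continuousAt_const
  | more k ih ih_succ =>
    exact ((hfactor (k + 1) (by omega)).mul (ih_succ fun j hj => hfactor j (by omega))).sub
      (hz.mul (ih fun j hj => hfactor j (by omega)))

theorem continuousAt_pVec {α : X → ℕ → ℂ} {τ : X → ℂ} {ζ s : ℂ} (hz : ContinuousAt z x) (p₀ : ℝ)
    (hβ : ∀ k ≤ n, ContinuousAt (fun y => beta n (α y) (τ y) ζ s k) x) :
    ContinuousAt (fun y => pVec n (α y) (τ y) ζ s p₀ (z y)) x :=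
  continuousAt_pi.2 fun i => continuousAt_pVal hz p₀ fun j hj => hβ j (by omega)

end Continuity

/-! ### Moving eigenvalues -/

section Branches

/-- Eigenvectors of a normal matrix for different eigenvalues are orthogonal, whereas those given by
a continuous nonzero field of eigenvectors are not as long as they are close to each other. -/
theorem exists_mem_nhds_subsingleton_spectrum_inter {𝕜 X m : Type*} [RCLike 𝕜]
    [TopologicalSpace X] [Fintype m] [DecidableEq m] {M : X → Matrix m m 𝕜} {v : X → 𝕜 → m → 𝕜}
    {x₀ : X} {z₀ : 𝕜}
    (hM : ∀ᶠ x in 𝓝 x₀, IsStarNormal (M x))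
    (hv : ∀ᶠ x in 𝓝 x₀, ∀ z ∈ spectrum 𝕜 (M x), M x *ᵥ v x z = z • v x z)
    (hcont : ContinuousAt (fun q : X × 𝕜 => v q.1 q.2) (x₀, z₀)) (hne : v x₀ z₀ ≠ 0) :
    ∃ V ∈ 𝓝 z₀, ∀ᶠ x in 𝓝 x₀, (spectrum 𝕜 (M x) ∩ V).Subsingleton := by
  let F : X × 𝕜 × 𝕜 → 𝕜 := fun q => star (v q.1 q.2.1) ⬝ᵥ v q.1 q.2.2
  have hfst : ContinuousAt (fun q : X × 𝕜 × 𝕜 => v q.1 q.2.1) (x₀, z₀, z₀) :=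
    ContinuousAt.comp (f := fun q : X × 𝕜 × 𝕜 => (q.1, q.2.1)) (x := (x₀, z₀, z₀)) hcont
      (by fun_prop)
  have hsnd : ContinuousAt (fun q : X × 𝕜 × 𝕜 => v q.1 q.2.2) (x₀, z₀, z₀) :=
    ContinuousAt.comp (f := fun q : X × 𝕜 × 𝕜 => (q.1, q.2.2)) (x := (x₀, z₀, z₀)) hcont
      (by fun_prop)
  have hF : ContinuousAt F (x₀, z₀, z₀) := tendsto_finsetSum _ fun i _ =>
    ((continuousAt_pi.1 hfst i).star).mul (continuousAt_pi.1 hsnd i)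
  have hF_ne : ∀ᶠ q in 𝓝 (x₀, z₀, z₀), F q ≠ 0 :=
    hF.eventually_ne (dotProduct_star_self_eq_zero.not.2 hne)
  obtain ⟨U, hU, W, hW, hUW⟩ := mem_nhds_prod_iff.1 hF_ne
  rw [nhds_prod_eq] at hW
  obtain ⟨V, hV, hVW⟩ := mem_prod_same_iff.1 hW
  refine ⟨V, hV, ?_⟩
  filter_upwards [hU, hM, hv] with x hxU hMx hvx z hz w hw
  have horth := star_dotProduct_mulVec_of_isStarNormal hMx (hvx z hz.1) (v x w)
  rw [hvx w hw.1, dotProduct_smul, smul_eq_mul] at horth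
  exact (mul_right_cancel₀ (hUW ⟨hxU, hVW ⟨hz.2, hw.2⟩⟩ : F (x, z, w) ≠ 0) horth).symm

theorem exists_continuousOn_exp_mul_I_eq {X : Type*} [TopologicalSpace X] {U : Set X} {η : X → ℂ}
    {z₀ : ℂ} (hη : ContinuousOn η U) (hnorm : ∀ x ∈ U, ‖η x‖ = 1) (hz₀ : ‖z₀‖ = 1)
    (hball : ∀ x ∈ U, η x ∈ Metric.ball z₀ 1) :
    ∃ θ : X → ℝ, ContinuousOn θ U ∧ ∀ x ∈ U, Complex.exp (θ x * Complex.I) = η x := by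
  have hz₀_ne : z₀ ≠ 0 := norm_ne_zero_iff.1 (by rw [hz₀]; exact one_ne_zero)
  have hexp_arg {z : ℂ} (hz : ‖z‖ = 1) : Complex.exp (Complex.arg z * Complex.I) = z := by
    simpa only [hz, Complex.ofReal_one, one_mul] using Complex.norm_mul_exp_arg_mul_I z
  have hslit : ∀ x ∈ U, η x / z₀ ∈ Complex.slitPlane := fun x hx => by
    refine Complex.ball_one_subset_slitPlane ?_
    rw [Metric.mem_ball, dist_eq_norm, div_sub_one hz₀_ne, norm_div, hz₀, div_one]
    exact mem_ball_iff_norm.1 (hball x hx)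
  refine ⟨fun x => Complex.arg z₀ + Complex.arg (η x / z₀), fun x hx => ?_, fun x hx => ?_⟩
  · exact continuousWithinAt_const.add (ContinuousAt.comp_continuousWithinAt
      (f := fun y => η y / z₀) (Complex.continuousAt_arg (hslit x hx)) ((hη x hx).div_const z₀))
  · have hquot : ‖η x / z₀‖ = 1 := by rw [norm_div, hnorm x hx, hz₀, div_one]
    rw [Complex.ofReal_add, add_mul, Complex.exp_add, hexp_arg hz₀, hexp_arg hquot,
      mul_div_cancel₀ _ hz₀_ne]

variable {n : ℕ} {α : ℝ → ℕ → ℂ} {τ : ℝ → ℂ} {I : Set ℝ} {t : ℝ} {z : ℂ}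

theorem IsDifferentiableFamilyAt.exists_mem_nhds_subsingleton
    (h : IsDifferentiableFamilyAt n α τ t) (hz : z ≠ 0) :
    ∃ V ∈ 𝓝 z, ∀ᶠ u in 𝓝 t, (spectrum ℂ (matG n (α u) (τ u)) ∩ V).Subsingleton := by
  refine exists_mem_nhds_subsingleton_spectrum_inter (v := fun u => eigenvector n (α u))
    (h.eventually_isVerblunsky.mono fun u hu => hu.isStarNormal_matG)
    (h.eventually_isVerblunsky.mono fun u hu w hw => hu.matG_mulVec_eigenvector_of_mem_spectrum hw)
    ?_ (eigenvector_ne_zero n (α t) z)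
  exact continuousAt_eigenvector continuousAt_snd hz
    (fun j hj => ContinuousAt.comp (f := Prod.fst) (x := (t, z))
      (h.differentiableAt_alpha hj).continuousAt continuousAt_fst) h.isVerblunsky.norm_alpha_lt

theorem exists_isEigenArg (hI : IsOpen I) (h : ∀ t ∈ I, IsDifferentiableFamilyAt n α τ t)
    (ht : t ∈ I) (hz : z ∈ spectrum ℂ (matG n (α t) (τ t))) :
    ∃ J : Set ℝ, IsOpen J ∧ J.OrdConnected ∧ J ⊆ I ∧ t ∈ J ∧ ∃ θ : ℝ → ℝ,
      IsEigenArg (fun t => matG n (α t) (τ t)) J θ ∧ Complex.exp (θ t * Complex.I) = z := by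
  have hV := (h t ht).isVerblunsky
  obtain ⟨V, hVz, hsub⟩ :=
    (h t ht).exists_mem_nhds_subsingleton (hV.ne_zero_of_mem_spectrum hz)
  obtain ⟨U, hU, hUo, htU⟩ := eventually_nhds_iff.1 (hsub.and (hI.eventually_mem ht))
  obtain ⟨U', hU'U, hU'o, htU', η, hηc, hηt, hη⟩ := exists_continuousOn_selection hUo
    (isOpen_interior.inter Metric.isOpen_ball) (V := interior V ∩ Metric.ball z 1)
    (fun u hu =>
      lowerHemicontinuousAt_spectrum (h u (hU u hu).2).differentiableAt_matG.continuousAt)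
    (fun u hu => (hU u hu).1.anti (inter_subset_inter_right _
      (inter_subset_left.trans interior_subset)))
    htU ⟨hz, mem_interior_iff_mem_nhds.2 hVz, Metric.mem_ball_self one_pos⟩
  obtain ⟨r, hr, hball⟩ := Metric.isOpen_iff.1 hU'o t htU'
  have hballI : Metric.ball t r ⊆ I := fun u hu => (hU u (hU'U (hball hu))).2
  obtain ⟨θ, hθc, hθ⟩ := exists_continuousOn_exp_mul_I_eq (hηc.mono hball)
    (fun u hu => (h u (hballI hu)).isVerblunsky.norm_eq_one_of_mem_spectrum (hη u (hball hu)).1)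
    (hV.norm_eq_one_of_mem_spectrum hz) fun u hu => (hη u (hball hu)).2.2
  have htr : t ∈ Metric.ball t r := Metric.mem_ball_self hr
  refine ⟨Metric.ball t r, Metric.isOpen_ball, ?_, hballI, htr, θ, ⟨hθc, fun u hu => ?_⟩, ?_⟩
  · rw [Real.ball_eq_Ioo]
    exact ordConnected_Ioo
  · rw [hθ u hu]
    exact (hη u (hball hu)).1
  · rw [hθ t htr, hηt]

end Branches

section Velocity

variable {n : ℕ} {α : ℝ → ℕ → ℂ} {τ : ℝ → ℂ} {ζ s : ℂ} {p₀ : ℝ} {θ : ℝ → ℝ} {t : ℝ}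

theorem hasDerivAt_matDeriv {m : Type*} [Finite m] {M : ℝ → Matrix m m ℂ}
    (hM : DifferentiableAt ℝ M t) : HasDerivAt M (matDeriv M t) t := by
  have := Fintype.ofFinite m
  exact hasDerivAt_pi.2 fun i => hasDerivAt_pi.2 fun k =>
    (differentiableAt_matrix_iff.1 hM i k).hasDerivAt

theorem differentiableAt_of_differentiableAt_exp_mul_I (hθ : ContinuousAt θ t)
    (h : DifferentiableAt ℝ (fun u => Complex.exp (θ u * Complex.I)) t) :
    DifferentiableAt ℝ θ t := by
  have hlog : DifferentiableAt ℝ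
      (fun u => Complex.log (Complex.exp (θ u * Complex.I) / Complex.exp (θ t * Complex.I))) t := by
    refine ((h.hasDerivAt.div_const (Complex.exp (θ t * Complex.I))).clog_real
      ?_).differentiableAt
    rw [div_self (Complex.exp_ne_zero _)]
    exact Complex.one_mem_slitPlane
  refine (DifferentiableAt.const_add (θ t) (Complex.imCLM.differentiableAt.comp t
    hlog)).congr_of_eventuallyEq ?_
  filter_upwards [Metric.tendsto_nhds.1 hθ Real.pi Real.pi_pos] with u hu
  rw [Real.dist_eq, abs_lt] at hu
  simp only [Function.comp_apply, Complex.imCLM_apply]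
  rw [← Complex.exp_sub, ← sub_mul, ← Complex.ofReal_sub, Complex.log_exp]
  · simp
  · simpa using hu.1
  · simpa using hu.2.le

theorem IsDifferentiableFamilyAt.differentiableAt_of_eventually_mem_spectrum
    (h : IsDifferentiableFamilyAt n α τ t) (hθ : ContinuousAt θ t)
    (heig : ∀ᶠ u in 𝓝 t, Complex.exp (θ u * Complex.I) ∈ spectrum ℂ (matG n (α u) (τ u))) :
    DifferentiableAt ℝ θ t := by
  have hz : ContinuousAt (fun u => Complex.exp (θ u * Complex.I)) t := by fun_prop
  have hvec : ContinuousAt (fun u => eigenvector n (α u) (Complex.exp (θ u * Complex.I))) t :=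
    continuousAt_eigenvector hz (Complex.exp_ne_zero _)
      (fun j hj => (h.differentiableAt_alpha hj).continuousAt) h.isVerblunsky.norm_alpha_lt
  refine differentiableAt_of_differentiableAt_exp_mul_I hθ
    (hasDerivAt_eigenvalue (hasDerivAt_matDeriv h.differentiableAt_matG)
      h.isVerblunsky.isStarNormal_matG hvec (eigenvector_ne_zero n _ _) ?_).differentiableAt
  filter_upwards [h.eventually_isVerblunsky, heig] with u hu hmem
  exact hu.matG_mulVec_eigenvector_of_mem_spectrum hmem

theorem hasDerivAt_cayley_exp_mul_I {θ' : ℝ} (hθ : HasDerivAt θ θ' t) (hζ : ‖ζ‖ = 1)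
    (hne : Complex.exp (θ t * Complex.I) ≠ ζ) :
    HasDerivAt (fun u => cayley ζ (Complex.exp (θ u * Complex.I)))
      ((-2 * θ' / ‖Complex.exp (θ t * Complex.I) - ζ‖ ^ 2 : ℝ) : ℂ) t := by
  have hexp : HasDerivAt (fun u => Complex.exp (θ u * Complex.I))
      (Complex.exp (θ t * Complex.I) * (θ' * Complex.I)) t :=
    (hθ.ofReal_comp.mul_const Complex.I).cexp
  have hquot := ((hexp.add_const ζ).const_mul Complex.I).fun_div (hexp.sub_const ζ)
    (sub_ne_zero.2 hne)
  refine hquot.congr_deriv (Eq.symm ?_)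
  have hz_conj := mul_conj_eq_one (Complex.norm_exp_ofReal_mul_I (θ t))
  have hζ_conj := mul_conj_eq_one hζ
  have hsub := sub_ne_zero.2 hne
  set z := Complex.exp (θ t * Complex.I)
  have hconj_sub : conj z - conj ζ ≠ 0 := by
    rw [← map_sub]
    exact (map_ne_zero _).2 hsub
  have hnorm : ((‖z - ζ‖ ^ 2 : ℝ) : ℂ) = (z - ζ) * (conj z - conj ζ) := by
    rw [← map_sub, Complex.mul_conj, Complex.normSq_eq_norm_sq]
  have hreflect : z - ζ = -(z * ζ * (conj z - conj ζ)) := by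
    linear_combination ζ * hz_conj - z * hζ_conj
  rw [Complex.ofReal_div, hnorm]
  push_cast
  rw [div_eq_div_iff (mul_ne_zero hsub hconj_sub) (pow_ne_zero _ hsub)]
  linear_combination (-2 * (θ' : ℂ) * (z - ζ)) * hreflect +
    2 * ((θ' : ℂ) * (z - ζ)) * z * ζ * (conj z - conj ζ) * Complex.I_sq

theorem star_mulVec_dotProduct_of_isHermitian {R m : Type*} [NonUnitalSemiring R] [StarRing R]
    [Fintype m] {A : Matrix m m R} (hA : A.IsHermitian) (x y : m → R) :
    star (A *ᵥ x) ⬝ᵥ y = star x ⬝ᵥ (A *ᵥ y) := by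
  rw [star_mulVec, hA.eq, ← dotProduct_mulVec]

theorem form_eq_star_dotProduct (n : ℕ) (α : ℝ → ℕ → ℂ) (τ : ℝ → ℂ) (ζ s : ℂ) (p₀ : ℝ) (η : ℂ)
    (t : ℝ) :
    form n α τ ζ s p₀ η t =
      star (sqrtH n (α t) (τ t) ζ s *ᵥ pVec n (α t) (τ t) ζ s p₀ η) ⬝ᵥ
        (matDeriv (fun u => matX n (α u) (τ u) ζ s) t *ᵥ
          (sqrtH n (α t) (τ t) ζ s *ᵥ pVec n (α t) (τ t) ζ s p₀ η)) := by
  rw [form, star_mulVec_dotProduct_of_isHermitian (isHermitian_sqrtH _ _ _ _ _), mulVec_mulVec,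
    mulVec_mulVec, Matrix.mul_assoc]

theorem IsDifferentiableFamilyAt.continuousAt_sqrtH_mulVec_pVec
    (h : IsDifferentiableFamilyAt n α τ t) (hζ : ‖ζ‖ = 1) (hs : s ^ 2 = ζ)
    (hS : ζ ∉ spectrum ℂ (matG n (α t) (τ t))) (p₀ : ℝ) {z : ℝ → ℂ} (hz : ContinuousAt z t) :
    ContinuousAt
      (fun u => sqrtH n (α u) (τ u) ζ s *ᵥ pVec n (α u) (τ u) ζ s p₀ (z u)) t := by
  have hp := continuousAt_pVec hz p₀ fun k hk => (h.differentiableAt_beta hζ hs hS hk).continuousAt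
  have hR := (h.differentiableAt_sqrtH hζ hs hS).continuousAt
  exact ((continuous_fst.matrix_mulVec continuous_snd).tendsto _).comp (hR.prodMk hp)

theorem IsDifferentiableFamilyAt.form_eq (h : IsDifferentiableFamilyAt n α τ t) (hζ : ‖ζ‖ = 1)
    (hs : s ^ 2 = ζ) (hS : ζ ∉ spectrum ℂ (matG n (α t) (τ t))) (hp₀ : p₀ ≠ 0)
    (hθ : DifferentiableAt ℝ θ t)
    (heig : ∀ᶠ u in 𝓝 t, Complex.exp (θ u * Complex.I) ∈ spectrum ℂ (matG n (α u) (τ u))) :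
    form n α τ ζ s p₀ (Complex.exp (θ t * Complex.I)) t =
      ((-2 * deriv θ t / ‖Complex.exp (θ t * Complex.I) - ζ‖ ^ 2 : ℝ) : ℂ) *
        (star (pVec n (α t) (τ t) ζ s p₀ (Complex.exp (θ t * Complex.I))) ⬝ᵥ
          (matH n (α t) (τ t) ζ s *ᵥ
            pVec n (α t) (τ t) ζ s p₀ (Complex.exp (θ t * Complex.I)))) := by
  have hH := h.isVerblunsky.posDef_matH hζ hs hS
  have hne : Complex.exp (θ t * Complex.I) ≠ ζ := fun hz => hS (hz ▸ heig.self_of_nhds)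
  have hz : ContinuousAt (fun u => Complex.exp (θ u * Complex.I)) t := by
    have := hθ.continuousAt
    fun_prop
  let v : ℝ → Fin (n + 1) → ℂ := fun u =>
    sqrtH n (α u) (τ u) ζ s *ᵥ pVec n (α u) (τ u) ζ s p₀ (Complex.exp (θ u * Complex.I))
  have hv : v t ≠ 0 := fun hv => pVec_ne_zero hp₀
    (mulVec_injective_of_isUnit (posDef_sqrtH hH).isUnit (hv.trans (mulVec_zero _).symm))
  have heigX : ∀ᶠ u in 𝓝 t, matX n (α u) (τ u) ζ s *ᵥ v u =
      cayley ζ (Complex.exp (θ u * Complex.I)) • v u := by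
    filter_upwards [h.eventually_isVerblunsky, h.eventually_notMem_spectrum_matG hS, heig]
      with u hu hSu hmem
    exact hu.matX_mulVec_sqrtH_mulVec_pVec hζ hs hSu p₀ hmem
  have hvelocity := (hasDerivAt_eigenvalue
    (hasDerivAt_matDeriv (h.differentiableAt_matX hζ hs hS))
    (isHermitian_matX _ _ _ _ _).isSelfAdjoint.isStarNormal
    (h.continuousAt_sqrtH_mulVec_pVec hζ hs hS p₀ hz) hv heigX).unique
      (hasDerivAt_cayley_exp_mul_I hθ.hasDerivAt hζ hne)
  rw [form_eq_star_dotProduct, (div_eq_iff (dotProduct_star_self_eq_zero.not.2 hv)).1 hvelocity,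
    star_mulVec_dotProduct_of_isHermitian (isHermitian_sqrtH _ _ _ _ _), mulVec_mulVec,
    sqrtH_mul_sqrtH hH]

theorem IsDifferentiableFamilyAt.deriv_pos_iff_form_neg (h : IsDifferentiableFamilyAt n α τ t)
    (hζ : ‖ζ‖ = 1) (hs : s ^ 2 = ζ) (hS : ζ ∉ spectrum ℂ (matG n (α t) (τ t))) (hp₀ : p₀ ≠ 0)
    (hθ : DifferentiableAt ℝ θ t)
    (heig : ∀ᶠ u in 𝓝 t, Complex.exp (θ u * Complex.I) ∈ spectrum ℂ (matG n (α u) (τ u))) :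
    0 < deriv θ t ↔ form n α τ ζ s p₀ (Complex.exp (θ t * Complex.I)) t < 0 := by
  have hne : Complex.exp (θ t * Complex.I) ≠ ζ := fun hz => hS (hz ▸ heig.self_of_nhds)
  have hnorm : 0 < ‖Complex.exp (θ t * Complex.I) - ζ‖ ^ 2 :=
    pow_pos (norm_pos_iff.2 (sub_ne_zero.2 hne)) 2
  have hHp := (h.isVerblunsky.posDef_matH hζ hs hS).dotProduct_mulVec_pos
    (pVec_ne_zero (n := n) (α := α t) (τ := τ t) (ζ := ζ) (s := s)
      (z := Complex.exp (θ t * Complex.I)) hp₀)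
  obtain ⟨r, hr, hHp_eq⟩ : ∃ r : ℝ, 0 < r ∧ (r : ℂ) = _ := RCLike.pos_iff_exists_ofReal.1 hHp
  have hneg : -(-2 * deriv θ t / ‖Complex.exp (θ t * Complex.I) - ζ‖ ^ 2 * r) =
      deriv θ t * (2 * r / ‖Complex.exp (θ t * Complex.I) - ζ‖ ^ 2) := by
    ring
  rw [h.form_eq hζ hs hS hp₀ hθ heig, ← hHp_eq, ← Complex.ofReal_mul, ← Complex.ofReal_zero,
    Complex.real_lt_real, ← neg_pos (a := _ * r), hneg, mul_pos_iff_of_pos_right (by positivity)]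

end Velocity

end POPUC

end

theorem mainTheorem2 (n : ℕ) (I : Set ℝ) (hI : IsOpen I) (hIc : I.OrdConnected)
    (α : ℝ → ℕ → ℂ) (τ : ℝ → ℂ)
    (hα : ∀ t ∈ I, ∀ j < n, ‖α t j‖ < 1) (hτ : ∀ t ∈ I, ‖τ t‖ = 1)
    (hG : ∀ i k, DifferentiableOn ℝ (fun t => POPUC.matG n (α t) (τ t) i k) I)
    (ζ s : ℂ) (hζ : ‖ζ‖ = 1) (hs : s ^ 2 = ζ) (p₀ : ℝ) (hp₀ : p₀ ≠ 0) :
    -- the eigenvalues are the zeros of the paraorthogonal polynomial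
    (∀ t ∈ I, ∀ z : ℂ, (POPUC.popuc n (α t) (τ t)).IsRoot z ↔
      z ∈ spectrum ℂ (POPUC.matG n (α t) (τ t))) ∧
    -- the objects in the criterion are well defined
    (∀ t ∈ I, ζ ∉ spectrum ℂ (POPUC.matG n (α t) (τ t)) →
      (POPUC.matH n (α t) (τ t) ζ s).PosDef ∧
      ∀ i k, DifferentiableAt ℝ (fun u => POPUC.matX n (α u) (τ u) ζ s i k) t) ∧
    -- every eigenvalue belongs to a moving eigenvalue
    (∀ t₀ ∈ I, ∀ η ∈ spectrum ℂ (POPUC.matG n (α t₀) (τ t₀)),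
      ∃ J : Set ℝ, IsOpen J ∧ J.OrdConnected ∧ J ⊆ I ∧ t₀ ∈ J ∧
        ∃ θ : ℝ → ℝ, POPUC.IsEigenArg (fun t => POPUC.matG n (α t) (τ t)) J θ ∧
          Complex.exp (θ t₀ * Complex.I) = η) ∧
    -- the criterion, for every moving eigenvalue `exp (i θ(t))`
    (∀ J : Set ℝ, IsOpen J → J.OrdConnected → J ⊆ I → ∀ θ : ℝ → ℝ,
      POPUC.IsEigenArg (fun t => POPUC.matG n (α t) (τ t)) J θ →
      (∀ t ∈ J, DifferentiableAt ℝ θ t) ∧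
      (∀ t ∈ J, ζ ∉ spectrum ℂ (POPUC.matG n (α t) (τ t)) →
        (0 < deriv θ t ↔
          POPUC.form n α τ ζ s p₀ (Complex.exp (θ t * Complex.I)) t < 0)) ∧
      (∀ T : Set ℝ, T ⊆ J → T.OrdConnected →
        (∀ t ∈ T, ζ ∉ spectrum ℂ (POPUC.matG n (α t) (τ t)) ∧
          POPUC.form n α τ ζ s p₀ (Complex.exp (θ t * Complex.I)) t < 0) →
        StrictMonoOn θ T)) := by
  have hfam : ∀ t ∈ I, POPUC.IsDifferentiableFamilyAt n α τ t := fun t ht =>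
    ⟨(hI.eventually_mem ht).mono fun u hu => ⟨hα u hu, hτ u hu⟩,
      POPUC.differentiableAt_matrix_iff.2 fun i k => (hG i k).differentiableAt (hI.mem_nhds ht)⟩
  refine ⟨fun t _ z => Matrix.mem_spectrum_iff_isRoot_charpoly.symm,
    fun t ht hS => ⟨(hfam t ht).isVerblunsky.posDef_matH hζ hs hS,
      POPUC.differentiableAt_matrix_iff.1 ((hfam t ht).differentiableAt_matX hζ hs hS)⟩,
    fun t₀ ht₀ η hη => POPUC.exists_isEigenArg hI hfam ht₀ hη, fun J hJ _ hJI θ hθ => ?_⟩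
  have heig : ∀ t ∈ J, ∀ᶠ u in 𝓝 t,
      Complex.exp (θ u * Complex.I) ∈ spectrum ℂ (POPUC.matG n (α u) (τ u)) := fun t ht =>
    (hJ.eventually_mem ht).mono hθ.2
  have hdiff : ∀ t ∈ J, DifferentiableAt ℝ θ t := fun t ht =>
    (hfam t (hJI ht)).differentiableAt_of_eventually_mem_spectrum
      (hθ.1.continuousAt (hJ.mem_nhds ht)) (heig t ht)
  have hcrit : ∀ t ∈ J, ζ ∉ spectrum ℂ (POPUC.matG n (α t) (τ t)) →
      (0 < deriv θ t ↔ POPUC.form n α τ ζ s p₀ (Complex.exp (θ t * Complex.I)) t < 0) :=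
    fun t ht hS => (hfam t (hJI ht)).deriv_pos_iff_form_neg hζ hs hS hp₀ (hdiff t ht) (heig t ht)
  refine ⟨hdiff, hcrit, fun T hTJ hTc hT =>
    strictMonoOn_of_deriv_pos hTc.convex (hθ.1.mono hTJ) fun t ht => ?_⟩
  obtain ⟨hS, hneg⟩ := hT t (interior_subset ht)
  exact (hcrit t (hTJ (interior_subset ht)) hS).2 hneg
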